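/- **Proposition.** Let $\mathbb B^4$ be the open Euclidean unit ball in $\mathbb R^4$ with boundary $\mathbb S^3$, outward unit normal $\nu$, and let $$P^{3,b}=-\tfrac12\,\partial_\nu\Delta-\Delta_{\mathbb S^3}\partial_\nu-\Delta_{\mathbb S^3}\quad\text{on }\mathbb S^3 .$$ Consider the eigenvalue problem: find $\Lambda\in\mathbb R$ and $0\not\equiv\varphi\in H^2(\mathbb B^4)$ with $$\Delta^2\varphi=0\ \text{ in }\mathbb B^4,\qquad P^{3,b}\varphi=\Lambda\varphi\ \text{ and }\ \partial_\nu\varphi=0\ \text{ on }\mathbb S^3 ,$$ where $\Delta^2\varphi=0$ holds in the sense of distributions, and boundary values and $P^{3,b}\varphi$ are understood in the weak sense given by Green's formula. Then: 1. The eigenvalues are exactly the numbers $\Lambda_{(k)}=k(k+1)(k+2)$, $k=0,1,2,\dots$ 2. The eigenspace of $\Lambda_{(k)}$ has dimension $(k+1)^2$. 3. Call $\psi\in H^1(\mathbb B^4)$ a Steklov solution for $k$ if $\Delta\psi=0$ in $\mathbb B^4$ and $\partial_\nu\psi=k\psi$ on $\mathbb S^3$. Every such $\psi$ has a unique extension $\varphi\in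 H^2(\mathbb B^4)$ of its boundary values with $\Delta^2\varphi=0$ in $\mathbb B^4$, $\varphi=\psi$ and $\partial_\nu\varphi=0$ on $\mathbb S^3$, and the eigenspace of $\Lambda_{(k)}$ consists exactly of these extensions. 4. Explicitly, the Steklov solutions for $k$ are the homogeneous harmonic polynomials $p$ of degree $k$, and the eigenspace of $\Lambda_{(k)}$ consists of the functions $\varphi(x)=\tfrac12\bigl(k+2-k|x|^2\bigr)\,p(x)$ with such $p$. In particular the boundary values of the eigenfunctions for $\Lambda_{(k)}$ are the spherical harmonics of degree $k$. 5. For every $\Lambda\in\mathbb R$, the $H^2$ solutions $\varphi$ (zero included) are exactly the functions on $\mathbb B^4$ that are restrictions of some $f\in C^\infty(\mathbb R^4)$ satisfying the three equations pointwise. 6. Listed in nondecreasing order and repeated according to multiplicity, the spectrum begins $$0=\Lambda_0<6=\Lambda_1=\Lambda_2=\Lambda_3=\Lambda_4<24=\Lambda_5\le\cdots.$$ -/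

import Mathlib

open MeasureTheory Metric Set
open scoped ContDiff

noncomputable section

namespace FlatBall

/-- Euclidean four-space. -/
abbrev E4 : Type := EuclideanSpace ℝ (Fin 4)

/-- Lebesgue measure on the open unit ball of `ℝ⁴`. -/
abbrev ballMeasure : Measure E4 := volume.restrict (ball (0 : E4) 1)

/-- The unit sphere `S³` in `ℝ⁴`. -/
abbrev S3 : Type := sphere (0 : E4) 1

/-- The surface measure of `S³` (of total mass `2 π ^ 2`). -/
abbrev sphereMeasure : Measure S3 := (volume : Measure E4).toSphere

/-- `L²(B⁴)`: classes of functions modulo almost everywhere equality. -/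
abbrev L2Ball : Type := Lp ℝ 2 ballMeasure

/-- `L²(S³)`. -/
abbrev L2Sphere : Type := Lp ℝ 2 sphereMeasure

/-- The `i`-th partial derivative of a function on `ℝ⁴`. -/
def partialD (i : Fin 4) (f : E4 → ℝ) (x : E4) : ℝ :=
  fderiv ℝ f x (EuclideanSpace.single i (1 : ℝ))

/-- The Euclidean Laplacian. -/
def lap (f : E4 → ℝ) : E4 → ℝ := Laplacian.laplacian f

/-- The radial derivative `x ↦ ⟨∇ f (x), x⟩`; on `S³` this is the outward normal derivative. -/
def normalD (f : E4 → ℝ) (x : E4) : ℝ := fderiv ℝ f x x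

/-- The Laplace–Beltrami operator of the round sphere `S³`, applied to the restriction of `f` to
`S³`: at a point of `S³` it is the Euclidean Laplacian of the extension of `f|_{S³}` that is
constant along rays. -/
def sphereLap (f : E4 → ℝ) : E4 → ℝ := lap fun y => f (‖y‖⁻¹ • y)

/-- The boundary operator `P^{3,b} = -½ ∂_ν Δ - Δ_{S³} ∂_ν - Δ_{S³}` of the flat ball, on functions
that are smooth up to the boundary. -/
def P3b (f : E4 → ℝ) (x : E4) : ℝ :=
  -(1 / 2) * normalD (lap f) x - sphereLap (normalD f) x - sphereLap f x

/-- `f`, smooth up to the boundary, solves pointwise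
`Δ² f = 0` in `B⁴`, `P^{3,b} f = Λ f` and `∂_ν f = 0` on `S³`. -/
def IsClassicalSolution (Λ : ℝ) (f : E4 → ℝ) : Prop :=
  ContDiff ℝ ∞ f ∧
  (∀ x ∈ ball (0 : E4) 1, lap (lap f) x = 0) ∧
  (∀ x ∈ sphere (0 : E4) 1, P3b f x = Λ * f x) ∧
  (∀ x ∈ sphere (0 : E4) 1, normalD f x = 0)

/-! ### Integration against smooth functions -/

/-- `∫_{B⁴} u f`. -/
def ballInt (u : L2Ball) (f : E4 → ℝ) : ℝ := ∫ x, u x * f x ∂ballMeasure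

/-- `∫_{S³} t f`. -/
def sphereInt (t : L2Sphere) (f : E4 → ℝ) : ℝ := ∫ x, t x * f (x : E4) ∂sphereMeasure

instance : IsFiniteMeasure ballMeasure :=
  ⟨by simpa [ballMeasure] using measure_ball_lt_top⟩

lemma ball_integrable (u : L2Ball) {f : E4 → ℝ} (hf : Continuous f) :
    Integrable (fun x => u x * f x) ballMeasure := by
  obtain ⟨C, hC⟩ := (isCompact_closedBall (0 : E4) 1).exists_bound_of_continuousOn hf.continuousOn
  refine ((Lp.memLp u).integrable (by norm_num)).mul_bdd (c := C)
    hf.aestronglyMeasurable ?_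
  filter_upwards [ae_restrict_mem measurableSet_ball] with x hx
  exact hC x (ball_subset_closedBall hx)

lemma sphere_integrable (t : L2Sphere) {f : E4 → ℝ} (hf : ContinuousOn f (sphere (0 : E4) 1)) :
    Integrable (fun x : S3 => t x * f (x : E4)) sphereMeasure := by
  obtain ⟨C, hC⟩ := (isCompact_sphere (0 : E4) 1).exists_bound_of_continuousOn hf
  exact ((Lp.memLp t).integrable (by norm_num)).mul_bdd (c := C)
    (hf.domRestrict.aestronglyMeasurable) (Filter.Eventually.of_forall fun x => hC x x.2)

lemma ballInt_add (u v : L2Ball) {f : E4 → ℝ} (hf : Continuous f) :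
    ballInt (u + v) f = ballInt u f + ballInt v f := by
  unfold ballInt
  rw [← integral_add (ball_integrable u hf) (ball_integrable v hf)]
  refine integral_congr_ae ?_
  filter_upwards [Lp.coeFn_add u v] with x hx
  rw [hx, Pi.add_apply, add_mul]

lemma ballInt_smul (c : ℝ) (u : L2Ball) (f : E4 → ℝ) :
    ballInt (c • u) f = c * ballInt u f := by
  unfold ballInt
  rw [← integral_const_mul]
  refine integral_congr_ae ?_
  filter_upwards [Lp.coeFn_smul c u] with x hx
  rw [hx, Pi.smul_apply, smul_eq_mul, mul_assoc]

lemma sphereInt_add (s t : L2Sphere) {f : E4 → ℝ} (hf : ContinuousOn f (sphere (0 : E4) 1)) :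
    sphereInt (s + t) f = sphereInt s f + sphereInt t f := by
  unfold sphereInt
  rw [← integral_add (sphere_integrable s hf) (sphere_integrable t hf)]
  refine integral_congr_ae ?_
  filter_upwards [Lp.coeFn_add s t] with x hx
  rw [hx, Pi.add_apply, add_mul]

lemma sphereInt_smul (c : ℝ) (t : L2Sphere) (f : E4 → ℝ) :
    sphereInt (c • t) f = c * sphereInt t f := by
  unfold sphereInt
  rw [← integral_const_mul]
  refine integral_congr_ae ?_
  filter_upwards [Lp.coeFn_smul c t] with x hx
  rw [hx, Pi.smul_apply, smul_eq_mul, mul_assoc]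

lemma continuous_partialD (i : Fin 4) {f : E4 → ℝ} (hf : ContDiff ℝ ∞ f) :
    Continuous (partialD i f) :=
  (hf.continuous_fderiv (by simp)).clm_apply continuous_const

lemma continuous_lap {f : E4 → ℝ} (hf : ContDiff ℝ ∞ f) : Continuous (lap f) := by
  have h : lap f = fun x => ∑ i, iteratedFDeriv ℝ 2 f x
      ![stdOrthonormalBasis ℝ E4 i, stdOrthonormalBasis ℝ E4 i] := by
    unfold lap
    rw [InnerProductSpace.laplacian_eq_iteratedFDeriv_stdOrthonormalBasis]
  rw [h]
  have h2 : Continuous (iteratedFDeriv ℝ 2 f) :=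
    hf.continuous_iteratedFDeriv (WithTop.coe_le_coe.2 le_top)
  refine continuous_finsetSum _ fun i _ => ?_
  have h3 := (ContinuousMultilinearMap.apply ℝ (fun _ : Fin 2 => E4) ℝ
    ![stdOrthonormalBasis ℝ E4 i, stdOrthonormalBasis ℝ E4 i]).continuous.comp h2
  exact h3

lemma continuousOn_sphereLap {f : E4 → ℝ} (hf : ContDiff ℝ ∞ f) :
    ContinuousOn (sphereLap f) (sphere (0 : E4) 1) := by
  intro x hx
  have hx0 : x ≠ 0 := by
    rintro rfl
    simp at hx
  set g : E4 → ℝ := fun y => f (‖y‖⁻¹ • y) with hg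
  have hgx : ContDiffAt ℝ 2 g x := by
    refine ContDiffAt.comp x (hf.contDiffAt.of_le (WithTop.coe_le_coe.2 le_top)) ?_
    exact ((contDiffAt_norm ℝ hx0).inv (norm_ne_zero_iff.mpr hx0)).smul contDiffAt_id
  have h : sphereLap f = fun y => ∑ i, iteratedFDeriv ℝ 2 g y
      ![stdOrthonormalBasis ℝ E4 i, stdOrthonormalBasis ℝ E4 i] := by
    unfold sphereLap lap
    rw [InnerProductSpace.laplacian_eq_iteratedFDeriv_stdOrthonormalBasis]
  rw [h]
  have h2 : ContinuousAt (iteratedFDeriv ℝ 2 g) x :=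
    hgx.continuousAt_iteratedFDeriv (by norm_num)
  refine ContinuousAt.continuousWithinAt (tendsto_finsetSum _ fun i _ => ?_)
  have h3 := (ContinuousMultilinearMap.apply ℝ (fun _ : Fin 2 => E4) ℝ
    ![stdOrthonormalBasis ℝ E4 i, stdOrthonormalBasis ℝ E4 i]).continuous.continuousAt.comp h2
  exact h3

/-! ### Weak derivatives, Sobolev spaces and traces on the ball -/

/-- Test functions: smooth, with compact support in the open unit ball. -/
def IsTest (η : E4 → ℝ) : Prop :=
  ContDiff ℝ ∞ η ∧ HasCompactSupport η ∧ tsupport η ⊆ ball (0 : E4) 1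

/-- `v` is the weak partial derivative `∂_i u` in `B⁴`. -/
def HasWeakPartial (i : Fin 4) (u v : L2Ball) : Prop :=
  ∀ η, IsTest η → ballInt u (partialD i η) = -ballInt v η

/-- `g` is the weak gradient of `u` in `B⁴`. -/
def HasWeakGrad (u : L2Ball) (g : Fin 4 → L2Ball) : Prop := ∀ i, HasWeakPartial i u (g i)

/-- `w = Δ u` in the sense of distributions in `B⁴`. -/
def HasWeakLap (u w : L2Ball) : Prop :=
  ∀ η, IsTest η → ballInt u (lap η) = ballInt w η

/-- `u ∈ H²(B⁴)`: `u` has weak derivatives of orders one and two in `L²`. -/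
def MemH2 (u : L2Ball) : Prop :=
  ∃ g, HasWeakGrad u g ∧ ∀ i, ∃ h, HasWeakGrad (g i) h

/-- `u ∈ H¹(B⁴)` and `t` is its trace on `S³`, that is,
`∫_B u ∂_i η + ∫_B (∂_i u) η = ∫_{S³} t η ν_i` for all `η` smooth up to the boundary. -/
def HasTrace (u : L2Ball) (t : L2Sphere) : Prop :=
  ∃ g, HasWeakGrad u g ∧ ∀ i, ∀ η : E4 → ℝ, ContDiff ℝ ∞ η →
    ballInt u (partialD i η) + ballInt (g i) η = sphereInt t (fun x => η x * x i)

/-- `u ∈ H¹(B⁴)`, `Δ u ∈ L²(B⁴)` and `n = ∂_ν u` on `S³`, that is,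
`∫_B ∇u · ∇η + ∫_B (Δ u) η = ∫_{S³} n η` for all `η` smooth up to the boundary. For `u ∈ H²(B⁴)`
this is the same as `n = ∑ i, ν_i ∂_i u` with `∂_i u` taken in the sense of traces. -/
def HasNormalDeriv (u : L2Ball) (n : L2Sphere) : Prop :=
  ∃ g w, HasWeakGrad u g ∧ HasWeakLap u w ∧ ∀ η : E4 → ℝ, ContDiff ℝ ∞ η →
    (∑ i, ballInt (g i) (partialD i η)) + ballInt w η = sphereInt n η

/-- `Δ² u = 0` in `B⁴` (in the sense of distributions, with `Δ u ∈ L²`). -/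
def IsBiharmonic (u : L2Ball) : Prop := ∃ w, HasWeakLap u w ∧ HasWeakLap w 0

/-- `p = P^{3,b} u = -½ ∂_ν Δ u - Δ_{S³} ∂_ν u - Δ_{S³} u` on `S³` in the weak sense, for `u` with
`Δ u, Δ² u ∈ L²(B⁴)`. If `u` and `ψ` are smooth up to the boundary and `∂_ν ψ = 0` then
`-∫_{S³} (∂_ν Δ u) ψ = ∫_B Δu Δψ - ∫_B (Δ² u) ψ` by Green's formula, and `Δ_{S³}` is symmetric;
such `ψ` attain every smooth function on `S³` as boundary values. -/
def HasP3b (u : L2Ball) (p : L2Sphere) : Prop :=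
  ∃ w z t n, HasWeakLap u w ∧ HasWeakLap w z ∧ HasTrace u t ∧ HasNormalDeriv u n ∧
    ∀ ψ : E4 → ℝ, ContDiff ℝ ∞ ψ → (∀ x ∈ sphere (0 : E4) 1, normalD ψ x = 0) →
      (1 / 2) * (ballInt w (lap ψ) - ballInt z ψ)
        - sphereInt n (sphereLap ψ) - sphereInt t (sphereLap ψ) = sphereInt p ψ

/-! ### The two eigenvalue problems -/

/-- `φ ∈ H²(B⁴)` solves `Δ² φ = 0` in `B⁴`, `P^{3,b} φ = Λ φ` and `∂_ν φ = 0` on `S³`. -/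
def IsSolution (Λ : ℝ) (φ : L2Ball) : Prop :=
  MemH2 φ ∧ IsBiharmonic φ ∧ (∃ t, HasTrace φ t ∧ HasP3b φ (Λ • t)) ∧ HasNormalDeriv φ 0

/-- `ψ ∈ H¹(B⁴)` solves `Δ ψ = 0` in `B⁴`, `∂_ν ψ = μ ψ` on `S³` (the Steklov problem). -/
def IsSteklovSolution (μ : ℝ) (ψ : L2Ball) : Prop :=
  HasWeakLap ψ 0 ∧ ∃ t, HasTrace ψ t ∧ HasNormalDeriv ψ (μ • t)

/-- `Λ` is an eigenvalue: the problem has a solution `φ ≢ 0`. -/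
def IsEigenvalue (Λ : ℝ) : Prop := ∃ φ : L2Ball, φ ≠ 0 ∧ IsSolution Λ φ

/-- `φ` is the biharmonic extension with vanishing normal derivative of the boundary values of
`ψ ∈ H¹(B⁴)`: `φ ∈ H²(B⁴)`, `Δ² φ = 0` in `B⁴`, `∂_ν φ = 0` and `φ = ψ` on `S³`. -/
def IsNeumannBiharmonicExtension (φ ψ : L2Ball) : Prop :=
  MemH2 φ ∧ IsBiharmonic φ ∧ HasNormalDeriv φ 0 ∧ ∃ t, HasTrace ψ t ∧ HasTrace φ t

/-- Homogeneous harmonic polynomials of degree `k` in four variables. -/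
def harmonicPolynomials (k : ℕ) : Set (MvPolynomial (Fin 4) ℝ) :=
  {p | p.IsHomogeneous k ∧ ∑ i, MvPolynomial.pderiv i (MvPolynomial.pderiv i p) = 0}

/-! ### Linearity -/

lemma IsTest.continuous_partialD {η : E4 → ℝ} (h : IsTest η) (i : Fin 4) :
    Continuous (partialD i η) := FlatBall.continuous_partialD i h.1

lemma HasWeakPartial.add {i : Fin 4} {u u' v v' : L2Ball} (h : HasWeakPartial i u v)
    (h' : HasWeakPartial i u' v') : HasWeakPartial i (u + u') (v + v') := by
  intro η hη
  rw [ballInt_add _ _ (hη.continuous_partialD i), ballInt_add _ _ hη.1.continuous, h η hη, h' η hη]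
  ring

lemma HasWeakPartial.smul {i : Fin 4} {u v : L2Ball} (c : ℝ) (h : HasWeakPartial i u v) :
    HasWeakPartial i (c • u) (c • v) := by
  intro η hη
  rw [ballInt_smul, ballInt_smul, h η hη]
  ring

lemma HasWeakGrad.add {u u' : L2Ball} {g g' : Fin 4 → L2Ball} (h : HasWeakGrad u g)
    (h' : HasWeakGrad u' g') : HasWeakGrad (u + u') (g + g') := fun i => (h i).add (h' i)

lemma HasWeakGrad.smul {u : L2Ball} {g : Fin 4 → L2Ball} (c : ℝ) (h : HasWeakGrad u g) :
    HasWeakGrad (c • u) (c • g) := fun i => (h i).smul c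

lemma HasWeakLap.add {u u' w w' : L2Ball} (h : HasWeakLap u w) (h' : HasWeakLap u' w') :
    HasWeakLap (u + u') (w + w') := by
  intro η hη
  rw [ballInt_add _ _ (continuous_lap hη.1), ballInt_add _ _ hη.1.continuous, h η hη, h' η hη]

lemma HasWeakLap.smul {u w : L2Ball} (c : ℝ) (h : HasWeakLap u w) :
    HasWeakLap (c • u) (c • w) := by
  intro η hη
  rw [ballInt_smul, ballInt_smul, h η hη]

lemma MemH2.add {u u' : L2Ball} (h : MemH2 u) (h' : MemH2 u') : MemH2 (u + u') := by
  obtain ⟨g, hg, k⟩ := h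
  obtain ⟨g', hg', k'⟩ := h'
  refine ⟨g + g', hg.add hg', fun i => ?_⟩
  obtain ⟨a, ha⟩ := k i
  obtain ⟨a', ha'⟩ := k' i
  exact ⟨a + a', ha.add ha'⟩

lemma MemH2.smul {u : L2Ball} (c : ℝ) (h : MemH2 u) : MemH2 (c • u) := by
  obtain ⟨g, hg, k⟩ := h
  refine ⟨c • g, hg.smul c, fun i => ?_⟩
  obtain ⟨a, ha⟩ := k i
  exact ⟨c • a, ha.smul c⟩

lemma HasTrace.add {u u' : L2Ball} {t t' : L2Sphere} (h : HasTrace u t) (h' : HasTrace u' t') :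
    HasTrace (u + u') (t + t') := by
  obtain ⟨g, hg, k⟩ := h
  obtain ⟨g', hg', k'⟩ := h'
  refine ⟨g + g', hg.add hg', fun i η hη => ?_⟩
  have hc : Continuous fun x : E4 => η x * x i :=
    hη.continuous.mul (EuclideanSpace.proj (𝕜 := ℝ) i).continuous
  rw [Pi.add_apply, ballInt_add _ _ (continuous_partialD i hη), ballInt_add _ _ hη.continuous,
    sphereInt_add _ _ hc.continuousOn, ← k i η hη, ← k' i η hη]
  ring

lemma HasTrace.smul {u : L2Ball} {t : L2Sphere} (c : ℝ) (h : HasTrace u t) :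
    HasTrace (c • u) (c • t) := by
  obtain ⟨g, hg, k⟩ := h
  refine ⟨c • g, hg.smul c, fun i η hη => ?_⟩
  rw [Pi.smul_apply, ballInt_smul, ballInt_smul, sphereInt_smul, ← k i η hη]
  ring

lemma HasNormalDeriv.add {u u' : L2Ball} {n n' : L2Sphere} (h : HasNormalDeriv u n)
    (h' : HasNormalDeriv u' n') : HasNormalDeriv (u + u') (n + n') := by
  obtain ⟨g, w, hg, hw, k⟩ := h
  obtain ⟨g', w', hg', hw', k'⟩ := h'
  refine ⟨g + g', w + w', hg.add hg', hw.add hw', fun η hη => ?_⟩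
  rw [ballInt_add _ _ hη.continuous, sphereInt_add _ _ hη.continuous.continuousOn, ← k η hη,
    ← k' η hη]
  simp only [Pi.add_apply, ballInt_add _ _ (continuous_partialD _ hη), Finset.sum_add_distrib]
  ring

lemma HasNormalDeriv.smul {u : L2Ball} {n : L2Sphere} (c : ℝ) (h : HasNormalDeriv u n) :
    HasNormalDeriv (c • u) (c • n) := by
  obtain ⟨g, w, hg, hw, k⟩ := h
  refine ⟨c • g, c • w, hg.smul c, hw.smul c, fun η hη => ?_⟩
  rw [ballInt_smul, sphereInt_smul, ← k η hη]
  simp only [Pi.smul_apply, ballInt_smul, ← Finset.mul_sum]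
  ring

lemma IsBiharmonic.add {u u' : L2Ball} (h : IsBiharmonic u) (h' : IsBiharmonic u') :
    IsBiharmonic (u + u') := by
  obtain ⟨w, hw, hz⟩ := h
  obtain ⟨w', hw', hz'⟩ := h'
  exact ⟨w + w', hw.add hw', by simpa using hz.add hz'⟩

lemma IsBiharmonic.smul {u : L2Ball} (c : ℝ) (h : IsBiharmonic u) : IsBiharmonic (c • u) := by
  obtain ⟨w, hw, hz⟩ := h
  exact ⟨c • w, hw.smul c, by simpa using hz.smul c⟩

lemma HasP3b.add {u u' : L2Ball} {p p' : L2Sphere} (h : HasP3b u p) (h' : HasP3b u' p') :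
    HasP3b (u + u') (p + p') := by
  obtain ⟨w, z, t, n, hw, hz, ht, hn, k⟩ := h
  obtain ⟨w', z', t', n', hw', hz', ht', hn', k'⟩ := h'
  refine ⟨w + w', z + z', t + t', n + n', hw.add hw', hz.add hz', ht.add ht', hn.add hn',
    fun ψ hψ hν => ?_⟩
  rw [ballInt_add _ _ (continuous_lap hψ), ballInt_add _ _ hψ.continuous,
    sphereInt_add _ _ (continuousOn_sphereLap hψ), sphereInt_add _ _ (continuousOn_sphereLap hψ),
    sphereInt_add _ _ hψ.continuous.continuousOn, ← k ψ hψ hν, ← k' ψ hψ hν]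
  ring

lemma HasP3b.smul {u : L2Ball} {p : L2Sphere} (c : ℝ) (h : HasP3b u p) :
    HasP3b (c • u) (c • p) := by
  obtain ⟨w, z, t, n, hw, hz, ht, hn, k⟩ := h
  refine ⟨c • w, c • z, c • t, c • n, hw.smul c, hz.smul c, ht.smul c, hn.smul c,
    fun ψ hψ hν => ?_⟩
  rw [ballInt_smul, ballInt_smul, sphereInt_smul, sphereInt_smul, sphereInt_smul, ← k ψ hψ hν]
  ring

lemma IsSolution.add {Λ : ℝ} {u u' : L2Ball} (h : IsSolution Λ u) (h' : IsSolution Λ u') :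
    IsSolution Λ (u + u') := by
  obtain ⟨h1, h2, ⟨t, ht, h3⟩, h4⟩ := h
  obtain ⟨h1', h2', ⟨t', ht', h3'⟩, h4'⟩ := h'
  exact ⟨h1.add h1', h2.add h2', ⟨t + t', ht.add ht', by simpa [smul_add] using h3.add h3'⟩,
    by simpa using h4.add h4'⟩

lemma IsSolution.smul {Λ : ℝ} {u : L2Ball} (c : ℝ) (h : IsSolution Λ u) :
    IsSolution Λ (c • u) := by
  obtain ⟨h1, h2, ⟨t, ht, h3⟩, h4⟩ := h
  exact ⟨h1.smul c, h2.smul c, ⟨c • t, ht.smul c, by simpa [smul_comm Λ c t] using h3.smul c⟩,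
    by simpa using h4.smul c⟩

lemma ballInt_zero (f : E4 → ℝ) : ballInt 0 f = 0 := by
  simpa using ballInt_smul 0 0 f

lemma sphereInt_zero (f : E4 → ℝ) : sphereInt 0 f = 0 := by
  simpa using sphereInt_smul 0 0 f

lemma isSolution_zero (Λ : ℝ) : IsSolution Λ 0 := by
  have hg : HasWeakGrad 0 0 := fun i η _ => by simp [ballInt_zero]
  have hl : HasWeakLap 0 0 := fun η _ => by simp [ballInt_zero]
  have ht : HasTrace 0 0 := ⟨0, hg, fun i η _ => by simp [ballInt_zero, sphereInt_zero]⟩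
  have hn : HasNormalDeriv 0 0 := ⟨0, 0, hg, hl, fun η _ => by simp [ballInt_zero, sphereInt_zero]⟩
  refine ⟨⟨0, hg, fun _ => ⟨0, hg⟩⟩, ⟨0, hl, hl⟩, ⟨0, ht, 0, 0, 0, 0, hl, hl, ht, hn, ?_⟩, hn⟩
  intro ψ _ _
  simp [ballInt_zero, sphereInt_zero]

/-- The eigenspace of `Λ`: all solutions in `H²(B⁴)`, as a linear subspace of `L²(B⁴)`. -/
def eigenspace (Λ : ℝ) : Submodule ℝ L2Ball where
  carrier := {φ | IsSolution Λ φ}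
  add_mem' h h' := h.add h'
  zero_mem' := isSolution_zero Λ
  smul_mem' c _ h := h.smul c

end FlatBall

end

/-!
Let `q` be a homogeneous harmonic polynomial of degree `j`. Green's formula for `φ` against `q`
turns `∫_B Δφ q` into `-j ∫_S φ q`, and testing the boundary operator against the biharmonic
function `½ (j + 2 - j |x|²) q`, which has the boundary values of `q` and vanishing normal
derivative, then gives `Λ ∫_S φ q = j (j + 1) (j + 2) ∫_S φ q`. So the trace of a solution is
orthogonal to all spherical harmonics except those of the single degree `k` with
`Λ = k (k + 1) (k + 2)`, and as spherical harmonics span a dense subspace (Fischer's decomposition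
and Stone–Weierstrass) it is a spherical harmonic of degree `k`. For the Steklov problem, Green's
formula alone gives the same conclusion.

A biharmonic `φ` is determined by its trace and normal derivative. If both vanish, Green's formula
shows that the weakly harmonic function `w = Δφ` is orthogonal to every harmonic polynomial; it is
also orthogonal to `Δ((1 - |x|²)² p)` for every polynomial `p`, as a cutoff argument shows, and
together these span all polynomials. Hence `w = 0`, and since `Δ` maps polynomials onto polynomials,
`φ` is orthogonal to every polynomial.
-/

namespace FlatBall

/-! ### Polar coordinates and the divergence theorem -/

section Polar

variable {E F : Type*} [NormedAddCommGroup E] [NormedSpace ℝ E] [FiniteDimensional ℝ E]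
  [Nontrivial E] [MeasurableSpace E] [BorelSpace E] [NormedAddCommGroup F] [NormedSpace ℝ F]
  (μ : Measure E) [μ.IsAddHaarMeasure]

lemma integral_volumeIoiPow (n : ℕ) (h : ℝ → F) :
    ∫ r : Ioi (0 : ℝ), h r ∂Measure.volumeIoiPow n = ∫ r in Ioi 0, r ^ n • h r := by
  simp only [Measure.volumeIoiPow, ENNReal.ofReal]
  rw [integral_withDensity_eq_integral_smul (by fun_prop),
    integral_subtype_comap measurableSet_Ioi fun r : ℝ => Real.toNNReal (r ^ n) • h r]
  refine setIntegral_congr_fun measurableSet_Ioi fun r (hr : 0 < r) => ?_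
  simp only [NNReal.smul_def, Real.coe_toNNReal _ (pow_pos hr n).le]

lemma integral_eq_integral_sphere_integral_Ioi {g : E → F} (hg : Integrable g μ) :
    ∫ x, g x ∂μ = ∫ θ : sphere (0 : E) 1,
      (∫ r in Ioi (0 : ℝ), r ^ (Module.finrank ℝ E - 1) • g (r • (θ : E))) ∂μ.toSphere := by
  have hpolar := μ.measurePreserving_homeomorphUnitSphereProd
  have hemb := (homeomorphUnitSphereProd E).measurableEmbedding
  let G : sphere (0 : E) 1 × Ioi (0 : ℝ) → F := fun p => g (p.2.1 • (p.1 : E))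
  have hG : G ∘ homeomorphUnitSphereProd E = g ∘ Subtype.val := funext fun x => by
    simp [G, smul_smul, norm_ne_zero_iff.2 x.2]
  have hGi : Integrable G (μ.toSphere.prod (.volumeIoiPow (Module.finrank ℝ E - 1))) := by
    rw [← hpolar.integrable_comp_emb hemb, hG]
    exact (integrableOn_iff_comap_subtypeVal (measurableSet_singleton _).compl).1 hg.integrableOn
  calc ∫ x, g x ∂μ = ∫ x : ({0}ᶜ : Set E), (G ∘ homeomorphUnitSphereProd E) x ∂μ.comap (↑) := by
        rw [hG]
        exact ((integral_subtype_comap (measurableSet_singleton _).compl g).trans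
          (by rw [restrict_compl_singleton])).symm
    _ = ∫ p, G p ∂μ.toSphere.prod (.volumeIoiPow _) := hpolar.integral_comp hemb G
    _ = _ := by
      rw [integral_prod _ hGi]
      exact integral_congr_ae (.of_forall fun θ =>
        integral_volumeIoiPow _ fun r => g (r • (θ : E)))

lemma setIntegral_ball_eq_integral_sphere {f : E → F} (hf : IntegrableOn f (ball 0 1) μ) :
    ∫ x in ball 0 1, f x ∂μ = ∫ θ : sphere (0 : E) 1,
      (∫ r in (0 : ℝ)..1, r ^ (Module.finrank ℝ E - 1) • f (r • (θ : E))) ∂μ.toSphere := by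
  rw [← integral_indicator measurableSet_ball, integral_eq_integral_sphere_integral_Ioi μ
    ((integrable_indicator_iff measurableSet_ball).2 hf)]
  refine integral_congr_ae (.of_forall fun θ => ?_)
  have hind : EqOn (fun r : ℝ => r ^ (Module.finrank ℝ E - 1) •
      (ball 0 1).indicator f (r • (θ : E))) ((Iio 1).indicator fun r : ℝ =>
      r ^ (Module.finrank ℝ E - 1) • f (r • (θ : E))) (Ioi 0) := fun r (hr : 0 < r) => by
    by_cases h1 : r < 1 <;> simp [indicator, norm_smul, abs_of_pos hr, h1]
  simp only []
  rw [setIntegral_congr_fun measurableSet_Ioi hind, setIntegral_indicator measurableSet_Iio,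
    Ioi_inter_Iio, intervalIntegral.integral_of_le zero_le_one, integral_Ioc_eq_integral_Ioo]

lemma setIntegral_ball_radial_divergence {g : E → ℝ} (hg : ContDiff ℝ 1 g) :
    ∫ x in ball 0 1, (Module.finrank ℝ E * g x + fderiv ℝ g x x) ∂μ =
      ∫ θ : sphere (0 : E) 1, g θ ∂μ.toSphere := by
  have hcont : Continuous fun x => Module.finrank ℝ E * g x + fderiv ℝ g x x :=
    (continuous_const.mul hg.continuous).add
      ((hg.continuous_fderiv one_ne_zero).clm_apply continuous_id)
  rw [setIntegral_ball_eq_integral_sphere μ ((hcont.continuousOn.integrableOn_compact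
    (isCompact_closedBall 0 1)).mono_set ball_subset_closedBall)]
  refine integral_congr_ae (.of_forall fun θ => ?_)
  obtain ⟨m, hm⟩ := Nat.exists_eq_succ_of_ne_zero (Module.finrank_pos (R := ℝ) (M := E)).ne'
  simp only [hm, Nat.succ_sub_one, smul_eq_mul] at hcont ⊢
  have hray (r : ℝ) : HasDerivAt (fun r : ℝ => r ^ (m + 1) * g (r • (θ : E)))
      (r ^ m * ((m + 1 : ℕ) * g (r • (θ : E)) + fderiv ℝ g (r • (θ : E)) (r • (θ : E)))) r := by
    have hline : HasDerivAt (fun r : ℝ => r • (θ : E)) (θ : E) r := by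
      simpa using (hasDerivAt_id r).smul_const (θ : E)
    refine ((hasDerivAt_pow (m + 1) r).mul ((hg.differentiable one_ne_zero
      (r • (θ : E))).hasFDerivAt.comp_hasDerivAt r hline)).congr_deriv ?_
    simp only [map_smul, smul_eq_mul, Nat.add_sub_cancel, Function.comp_apply]
    ring
  rw [intervalIntegral.integral_eq_sub_of_hasDerivAt (fun r _ => hray r)
    (Continuous.intervalIntegrable (by fun_prop) _ _)]
  simp

end Polar

/-- Smooth cutoffs on `ℝ`, vanishing on `(-∞, 1 / n]` and equal to `1` on `[2 / n, ∞)`. Composed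
with `x ↦ 1 - ‖x‖ ^ 2` they exhaust the open unit ball by compactly supported functions. -/
noncomputable def cutoff (n : ℕ) (s : ℝ) : ℝ := Real.smoothTransition (n * s - 1)

section Cutoff

variable {n : ℕ} {s : ℝ}

lemma contDiff_cutoff : ContDiff ℝ ∞ (cutoff n) :=
  Real.smoothTransition.contDiff.comp ((contDiff_const.mul contDiff_id).sub contDiff_const)

lemma cutoff_eq_zero (h : n * s ≤ 1) : cutoff n s = 0 :=
  Real.smoothTransition.zero_of_nonpos (by linarith)

lemma cutoff_eq_one (h : 2 ≤ n * s) : cutoff n s = 1 :=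
  Real.smoothTransition.one_of_one_le (by linarith)

lemma iteratedDeriv_cutoff (k n : ℕ) (s : ℝ) :
    iteratedDeriv k (cutoff n) s = n ^ k * iteratedDeriv k (cutoff 1) (n * s) := by
  have h : cutoff n = fun s => cutoff 1 (n * s) := by
    ext; simp [cutoff]
  rw [h, iteratedDeriv_comp_const_mul (contDiff_cutoff.of_le (by exact_mod_cast le_top))]

lemma iteratedDeriv_cutoff_eq_of_two_lt (k : ℕ) (h : 2 < n * s) :
    iteratedDeriv k (cutoff n) s = if k = 0 then 1 else 0 := by
  have hone : cutoff n =ᶠ[nhds s] fun _ => 1 := by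
    filter_upwards [(continuous_const.mul continuous_id).continuousAt.eventually
      (lt_mem_nhds h)] with t ht using cutoff_eq_one ht.le
  rw [(hone.iteratedDeriv k).eq_of_nhds, iteratedDeriv_const]

lemma iteratedDeriv_cutoff_eq_zero_of_lt_one (k : ℕ) (h : n * s < 1) :
    iteratedDeriv k (cutoff n) s = 0 := by
  have hzero : cutoff n =ᶠ[nhds s] fun _ => 0 := by
    filter_upwards [(continuous_const.mul continuous_id).continuousAt.eventually
      (gt_mem_nhds h)] with t ht using cutoff_eq_zero ht.le
  rw [(hzero.iteratedDeriv k).eq_of_nhds, iteratedDeriv_const, ite_self]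

-- For `k ≠ 0` the `k`-th derivative of `cutoff n` is of size `n ^ k`, but it lives where
-- `s ≈ 1 / n`.
lemma exists_forall_abs_pow_mul_iteratedDeriv_cutoff_le (k : ℕ) :
    ∃ C, ∀ n s, |s ^ k * iteratedDeriv k (cutoff n) s| ≤ C := by
  have hcont : Continuous (iteratedDeriv k (cutoff 1)) :=
    contDiff_cutoff.continuous_iteratedDeriv k (by exact_mod_cast le_top)
  obtain ⟨C, hC⟩ := (isCompact_Icc (a := (1 : ℝ)) (b := 2)).exists_bound_of_continuousOn
    ((continuous_pow k).mul hcont).continuousOn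
  refine ⟨max C 1, fun n s => ?_⟩
  have hscale : s ^ k * iteratedDeriv k (cutoff n) s =
      (n * s) ^ k * iteratedDeriv k (cutoff 1) (n * s) := by
    rw [iteratedDeriv_cutoff, mul_pow]
    ring
  rw [hscale]
  rcases lt_or_ge (n * s) 1 with h1 | h1
  · rw [iteratedDeriv_cutoff_eq_zero_of_lt_one k (by simpa using h1)]
    simp
  rcases le_or_gt (n * s) 2 with h2 | h2
  · exact (hC _ ⟨h1, h2⟩).trans (le_max_left _ _)
  · rw [iteratedDeriv_cutoff_eq_of_two_lt k (by simpa using h2)]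
    split_ifs with hk <;> simp [hk]

lemma tendsto_pow_mul_iteratedDeriv_cutoff (k : ℕ) (hs : 0 < s) :
    Filter.Tendsto (fun n => s ^ k * iteratedDeriv k (cutoff n) s) Filter.atTop
      (nhds (if k = 0 then 1 else 0)) := by
  refine tendsto_const_nhds.congr' ?_
  filter_upwards [(tendsto_natCast_atTop_atTop.atTop_mul_const hs).eventually_gt_atTop 2] with n hn
  rw [iteratedDeriv_cutoff_eq_of_two_lt k hn]
  split_ifs with hk <;> simp [hk]

variable {E : Type*} [NormedAddCommGroup E]

lemma tsupport_cutoff_one_sub_norm_sq_subset :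
    tsupport (fun x : E => cutoff n (1 - ‖x‖ ^ 2)) ⊆ ball 0 1 := by
  have hclosed : IsClosed {x : E | 1 ≤ n * (1 - ‖x‖ ^ 2)} :=
    isClosed_le continuous_const (by fun_prop)
  refine (closure_minimal (fun x hx => ?_) hclosed).trans ?_
  · exact le_of_not_ge fun h => hx (cutoff_eq_zero h)
  · intro x (hx : 1 ≤ n * (1 - ‖x‖ ^ 2))
    have : 0 < 1 - ‖x‖ ^ 2 := pos_of_mul_pos_right (one_pos.trans_le hx) n.cast_nonneg
    rw [mem_ball_zero_iff]
    nlinarith [norm_nonneg x]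

variable [MeasurableSpace E] [OpensMeasurableSpace E] {μ : Measure E}

lemma tendsto_setIntegral_mul_iteratedDeriv_cutoff {u : E → ℝ} (hu : IntegrableOn u (ball 0 1) μ)
    (k : ℕ) :
    Filter.Tendsto (fun n => ∫ x in ball 0 1,
      u x * ((1 - ‖x‖ ^ 2) ^ k * iteratedDeriv k (cutoff n) (1 - ‖x‖ ^ 2)) ∂μ) Filter.atTop
      (nhds (if k = 0 then ∫ x in ball 0 1, u x ∂μ else 0)) := by
  obtain ⟨C, hC⟩ := exists_forall_abs_pow_mul_iteratedDeriv_cutoff_le k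
  have hlim : (if k = 0 then ∫ x in ball 0 1, u x ∂μ else 0) =
      ∫ x in ball 0 1, u x * (if k = 0 then 1 else 0) ∂μ := by
    split_ifs <;> simp
  rw [hlim]
  refine tendsto_integral_of_dominated_convergence (fun x => ‖u x‖ * C) (fun n => ?_)
    (hu.norm.mul_const C) (fun n => .of_forall fun x => ?_) ?_
  · have hcont : Continuous (iteratedDeriv k (cutoff n)) :=
      contDiff_cutoff.continuous_iteratedDeriv k (by exact_mod_cast le_top)
    exact hu.aestronglyMeasurable.mul
      (Continuous.measurable (by fun_prop)).aestronglyMeasurable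
  · rw [norm_mul]
    exact mul_le_mul_of_nonneg_left (hC n _) (norm_nonneg _)
  · filter_upwards [ae_restrict_mem measurableSet_ball] with x hx
    have hx1 : ‖x‖ < 1 := mem_ball_zero_iff.1 hx
    exact (tendsto_pow_mul_iteratedDeriv_cutoff k
      (by nlinarith [norm_nonneg x])).const_mul _

end Cutoff

section DivergenceTheorem

variable {E : Type*} [NormedAddCommGroup E] [InnerProductSpace ℝ E]

lemma hasDerivAt_cutoff (n : ℕ) (s : ℝ) :
    HasDerivAt (cutoff n) (iteratedDeriv 1 (cutoff n) s) s := by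
  rw [iteratedDeriv_one]
  exact (contDiff_cutoff.differentiable (by simp) s).hasDerivAt

lemma contDiff_comp_one_sub_norm_sq {χ : ℝ → ℝ} {n : ℕ∞ω} (hχ : ContDiff ℝ n χ) :
    ContDiff ℝ n fun x : E => χ (1 - ‖x‖ ^ 2) :=
  hχ.comp (contDiff_const.sub (contDiff_norm_sq ℝ))

lemma hasFDerivAt_comp_one_sub_norm_sq {χ : ℝ → ℝ} {χ' : ℝ} {x : E}
    (hχ : HasDerivAt χ χ' (1 - ‖x‖ ^ 2)) :
    HasFDerivAt (fun y : E => χ (1 - ‖y‖ ^ 2)) ((-2 * χ') • innerSL ℝ x) x := by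
  refine (hχ.comp_hasFDerivAt x ((hasFDerivAt_id x).norm_sq.const_sub 1)).congr_fderiv ?_
  ext v
  simp only [id_eq, ContinuousLinearMap.comp_id, smul_neg, neg_apply, smul_apply,
    coe_innerSL_apply, nsmul_eq_mul, Nat.cast_ofNat, smul_eq_mul, neg_mul, neg_smul, neg_inj]
  ring

lemma fderiv_comp_one_sub_norm_sq_mul_apply {χ : ℝ → ℝ} {χ' : ℝ} {f : E → ℝ} {x : E}
    (hχ : HasDerivAt χ χ' (1 - ‖x‖ ^ 2)) (hf : DifferentiableAt ℝ f x) (v : E) :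
    fderiv ℝ (fun y => χ (1 - ‖y‖ ^ 2) * f y) x v =
      χ (1 - ‖x‖ ^ 2) * fderiv ℝ f x v - 2 * χ' * inner ℝ x v * f x := by
  rw [((hasFDerivAt_comp_one_sub_norm_sq hχ).fun_mul hf.hasFDerivAt).fderiv]
  simp only [neg_mul, neg_smul, smul_neg, add_apply, smul_apply, smul_eq_mul, neg_apply,
    coe_innerSL_apply]
  ring

variable [FiniteDimensional ℝ E] [MeasurableSpace E] [BorelSpace E] {μ : Measure E}
  {f : E → ℝ}

lemma integrableOn_ball_of_continuous [IsFiniteMeasureOnCompacts μ] (hf : Continuous f) :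
    IntegrableOn f (ball 0 1) μ :=
  (hf.continuousOn.integrableOn_compact (isCompact_closedBall 0 1)).mono_set ball_subset_closedBall

variable [μ.IsAddHaarMeasure]

lemma setIntegral_ball_fderiv_eq_zero (hf : ContDiff ℝ 1 f) (hsupp : tsupport f ⊆ ball 0 1)
    (v : E) : ∫ x in ball 0 1, fderiv ℝ f x v ∂μ = 0 := by
  have hcompact : HasCompactSupport f :=
    (isCompact_closedBall 0 1).of_isClosed_subset (isClosed_tsupport f)
      (hsupp.trans ball_subset_closedBall)
  have hcont : Continuous fun x => fderiv ℝ f x v :=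
    (hf.continuous_fderiv one_ne_zero).clm_apply continuous_const
  rw [setIntegral_eq_integral_of_forall_compl_eq_zero fun x hx => by
    rw [fderiv_of_notMem_tsupport ℝ fun h => hx (hsupp h), zero_apply]]
  simpa using integral_mul_fderiv_eq_neg_fderiv_mul_of_integrable (μ := μ) (f := fun _ => (1 : ℝ))
    (g := f) (v := v) (by simp)
    (by simpa using hcont.integrable_of_hasCompactSupport (hcompact.fderiv_apply ℝ v))
    (by simpa using hf.continuous.integrable_of_hasCompactSupport hcompact)
    (fun _ _ => differentiableAt_const _) fun x _ => hf.differentiable one_ne_zero x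

variable [Nontrivial E]

lemma setIntegral_ball_radial_divergence_eq_zero (hf : ContDiff ℝ 1 f)
    (hsupp : tsupport f ⊆ ball 0 1) :
    ∫ x in ball 0 1, (Module.finrank ℝ E * f x + fderiv ℝ f x x) ∂μ = 0 := by
  rw [setIntegral_ball_radial_divergence μ hf]
  refine integral_eq_zero_of_ae (.of_forall fun θ => image_eq_zero_of_notMem_tsupport fun h => ?_)
  simpa using hsupp h

-- The constant field `v` and the radial field `⟪x, v⟫ x` have the same normal component on the
-- unit sphere, so the derivative of the cutoff meets a difference of order `1 - ‖x‖ ^ 2`.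
lemma setIntegral_ball_mul_cutoff_eq (hf : ContDiff ℝ 1 f) (v : E) (n : ℕ) {g : E → ℝ}
    (hg : g = fun x => f x * inner ℝ x v) :
    ∫ x in ball 0 1, (fderiv ℝ f x v - (Module.finrank ℝ E * g x + fderiv ℝ g x x)) *
        ((1 - ‖x‖ ^ 2) ^ 0 * iteratedDeriv 0 (cutoff n) (1 - ‖x‖ ^ 2)) ∂μ =
      ∫ x in ball 0 1, (2 * g x) *
        ((1 - ‖x‖ ^ 2) ^ 1 * iteratedDeriv 1 (cutoff n) (1 - ‖x‖ ^ 2)) ∂μ := by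
  have hg1 : ContDiff ℝ 1 g := hg ▸ hf.mul (contDiff_id.inner ℝ contDiff_const)
  have hc : ContDiff ℝ 1 fun x : E => cutoff n (1 - ‖x‖ ^ 2) :=
    contDiff_comp_one_sub_norm_sq (contDiff_cutoff.of_le (by simp))
  have hsupp (h : E → ℝ) : tsupport (fun x => cutoff n (1 - ‖x‖ ^ 2) * h x) ⊆ ball 0 1 :=
    tsupport_mul_subset_left.trans tsupport_cutoff_one_sub_norm_sq_subset
  have hderiv (h : E → ℝ) (hh : ContDiff ℝ 1 h) (x : E) := fderiv_comp_one_sub_norm_sq_mul_apply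
    (hasDerivAt_cutoff n _) (hh.differentiable one_ne_zero x)
  have hint {h : E → ℝ} (hh : ContDiff ℝ 1 h) (a : ℝ) (w : E → E) (hw : Continuous w) :
      IntegrableOn (fun x => a * h x + fderiv ℝ h x (w x)) (ball 0 1) μ :=
    integrableOn_ball_of_continuous ((continuous_const.mul hh.continuous).add
      ((hh.continuous_fderiv one_ne_zero).clm_apply hw))
  have hconst := hint (hc.mul hf) 0 (fun _ => v) continuous_const
  have hradial := hint (hc.mul hg1) (Module.finrank ℝ E) (fun x => x) continuous_id
  have hrem : IntegrableOn (fun x => 2 * g x *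
      ((1 - ‖x‖ ^ 2) ^ 1 * iteratedDeriv 1 (cutoff n) (1 - ‖x‖ ^ 2))) (ball 0 1) μ := by
    have hχ : Continuous (iteratedDeriv 1 (cutoff n)) :=
      contDiff_cutoff.continuous_iteratedDeriv 1 (by simp)
    exact integrableOn_ball_of_continuous ((continuous_const.mul hg1.continuous).mul (by fun_prop))
  have hzero := integral_sub hconst hradial
  simp only [zero_mul, zero_add] at hconst hzero
  rw [setIntegral_ball_fderiv_eq_zero (hc.mul hf) (hsupp f) v,
    setIntegral_ball_radial_divergence_eq_zero (hc.mul hg1) (hsupp g), sub_zero] at hzero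
  rw [← add_zero (∫ x in ball 0 1, 2 * g x * _ ∂μ), ← hzero]
  refine (integral_congr_ae (.of_forall fun x => ?_)).trans
    (integral_add hrem (hconst.sub hradial))
  simp only [hderiv f hf, hderiv g hg1, iteratedDeriv_zero,
    real_inner_self_eq_norm_sq]
  rw [show g x = f x * inner ℝ x v from congrFun hg x]
  ring

theorem setIntegral_ball_fderiv (hf : ContDiff ℝ 1 f) (v : E) :
    ∫ x in ball 0 1, fderiv ℝ f x v ∂μ =
      ∫ θ : sphere (0 : E) 1, f θ * inner ℝ (θ : E) v ∂μ.toSphere := by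
  let g : E → ℝ := fun x => f x * inner ℝ x v
  have hg : ContDiff ℝ 1 g := hf.mul (contDiff_id.inner ℝ contDiff_const)
  have hint : IntegrableOn (fun x => fderiv ℝ f x v) (ball 0 1) μ :=
    integrableOn_ball_of_continuous
      ((hf.continuous_fderiv one_ne_zero).clm_apply continuous_const)
  have hint' : IntegrableOn (fun x => Module.finrank ℝ E * g x + fderiv ℝ g x x) (ball 0 1) μ :=
    integrableOn_ball_of_continuous ((continuous_const.mul hg.continuous).add
      ((hg.continuous_fderiv one_ne_zero).clm_apply continuous_id))
  have hlim := tendsto_setIntegral_mul_iteratedDeriv_cutoff (hint.sub hint') 0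
  have hlim' := tendsto_setIntegral_mul_iteratedDeriv_cutoff (μ := μ) (u := fun x => 2 * g x)
    (integrableOn_ball_of_continuous (continuous_const.mul hg.continuous)) 1
  simp only [if_true, one_ne_zero, if_false] at hlim hlim'
  have hzero := tendsto_nhds_unique hlim
    (hlim'.congr fun n => (setIntegral_ball_mul_cutoff_eq hf v n rfl).symm)
  simp only [Pi.sub_apply] at hzero
  rw [integral_sub hint hint', sub_eq_zero] at hzero
  rw [hzero, setIntegral_ball_radial_divergence μ hg]

end DivergenceTheorem

/-! ### Differential operators on `ℝ⁴` -/

section Calculus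

variable {f g : E4 → ℝ} {x : E4}

lemma partialD_congr {i : Fin 4} (h : f =ᶠ[nhds x] g) : partialD i f x = partialD i g x := by
  rw [partialD, partialD, h.fderiv_eq]

lemma partialD_sub {i : Fin 4} (hf : DifferentiableAt ℝ f x) (hg : DifferentiableAt ℝ g x) :
    partialD i (fun y => f y - g y) x = partialD i f x - partialD i g x := by
  simp only [partialD, fderiv_fun_sub hf hg, sub_apply]

lemma partialD_add {i : Fin 4} (hf : DifferentiableAt ℝ f x) (hg : DifferentiableAt ℝ g x) :
    partialD i (fun y => f y + g y) x = partialD i f x + partialD i g x := by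
  simp only [partialD, fderiv_fun_add hf hg, add_apply]

lemma partialD_mul {i : Fin 4} (hf : DifferentiableAt ℝ f x) (hg : DifferentiableAt ℝ g x) :
    partialD i (fun y => f y * g y) x = f x * partialD i g x + partialD i f x * g x := by
  simp only [partialD, fderiv_fun_mul hf hg, add_apply, smul_apply, smul_eq_mul, mul_comm]

lemma partialD_sum {ι : Type*} {i : Fin 4} {s : Finset ι} {F : ι → E4 → ℝ}
    (hF : ∀ j ∈ s, DifferentiableAt ℝ (F j) x) :
    partialD i (fun y => ∑ j ∈ s, F j y) x = ∑ j ∈ s, partialD i (F j) x := by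
  simp only [partialD, fderiv_fun_sum hF, sum_apply]

lemma partialD_const (i : Fin 4) (c : ℝ) (x : E4) : partialD i (fun _ => c) x = 0 := by
  simp [partialD]

lemma partialD_coord (i j : Fin 4) (x : E4) :
    partialD i (fun y => y j) x = if i = j then 1 else 0 := by
  rw [partialD, show (fun y : E4 => y j) = EuclideanSpace.proj (𝕜 := ℝ) j from rfl,
    ContinuousLinearMap.fderiv]
  simp [eq_comm]

lemma contDiff_coord (i : Fin 4) {n : ℕ∞ω} : ContDiff ℝ n (fun x : E4 => x i) :=
  (EuclideanSpace.proj (𝕜 := ℝ) i).contDiff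

lemma differentiableAt_of_contDiff (hf : ContDiff ℝ ∞ f) (x : E4) : DifferentiableAt ℝ f x :=
  hf.differentiable (by simp) x

lemma contDiffAt_two_of_contDiff (hf : ContDiff ℝ ∞ f) (x : E4) : ContDiffAt ℝ 2 f x :=
  hf.contDiffAt.of_le (WithTop.coe_le_coe.2 le_top)

lemma contDiff_partialD (i : Fin 4) (hf : ContDiff ℝ ∞ f) : ContDiff ℝ ∞ (partialD i f) :=
  (hf.fderiv_right (m := ∞) (by simp)).clm_apply contDiff_const

lemma contDiff_normalD (hf : ContDiff ℝ ∞ f) : ContDiff ℝ ∞ (normalD f) :=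
  (hf.fderiv_right (m := ∞) (by simp)).clm_apply contDiff_id

lemma differentiableAt_partialD (i : Fin 4) (hf : ContDiffAt ℝ 2 f x) :
    DifferentiableAt ℝ (partialD i f) x :=
  ((hf.fderiv_right (m := 1) (by norm_num)).clm_apply contDiffAt_const).differentiableAt one_ne_zero

lemma normalD_eq_sum (f : E4 → ℝ) (x : E4) : normalD f x = ∑ i, x i * partialD i f x := by
  have hx : x = ∑ i, x i • EuclideanSpace.single i (1 : ℝ) := by
    simpa using ((EuclideanSpace.basisFun (Fin 4) ℝ).sum_repr x).symm
  calc normalD f x = fderiv ℝ f x (∑ i, x i • EuclideanSpace.single i (1 : ℝ)) := by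
        rw [← hx, normalD]
    _ = ∑ i, x i * partialD i f x := by simp only [map_sum, map_smul, smul_eq_mul, partialD]

lemma partialD_partialD (hf : ContDiffAt ℝ 2 f x) (i j : Fin 4) :
    partialD i (partialD j f) x =
      iteratedFDeriv ℝ 2 f x ![EuclideanSpace.single i 1, EuclideanSpace.single j 1] := by
  have hd : DifferentiableAt ℝ (fderiv ℝ f) x :=
    (hf.fderiv_right (m := 1) (by norm_num)).differentiableAt one_ne_zero
  rw [iteratedFDeriv_two_apply]
  unfold partialD
  rw [fderiv_clm_apply hd (differentiableAt_const _)]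
  simp

lemma partialD_comm (hf : ContDiffAt ℝ 2 f x) (i j : Fin 4) :
    partialD i (partialD j f) x = partialD j (partialD i f) x := by
  rw [partialD_partialD hf, partialD_partialD hf, iteratedFDeriv_two_apply,
    iteratedFDeriv_two_apply]
  exact hf.isSymmSndFDerivAt (by simp) _ _

lemma lap_eq_sum (hf : ContDiffAt ℝ 2 f x) : lap f x = ∑ i, partialD i (partialD i f) x := by
  rw [lap, InnerProductSpace.laplacian_eq_iteratedFDeriv_orthonormalBasis f
    (EuclideanSpace.basisFun (Fin 4) ℝ)]
  exact Finset.sum_congr rfl fun i _ => by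
    rw [partialD_partialD hf]; simp only [EuclideanSpace.basisFun_apply]

lemma contDiff_lap (hf : ContDiff ℝ ∞ f) : ContDiff ℝ ∞ (lap f) := by
  rw [show lap f = fun x => ∑ i, partialD i (partialD i f) x from
    funext fun x => lap_eq_sum (contDiffAt_two_of_contDiff hf x)]
  exact ContDiff.sum fun i _ => contDiff_partialD i (contDiff_partialD i hf)

lemma lap_mul (hf : ContDiff ℝ ∞ f) (hg : ContDiff ℝ ∞ g) (x : E4) :
    lap (fun y => f y * g y) x =
      f x * lap g x + 2 * (∑ i, partialD i f x * partialD i g x) + lap f x * g x := by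
  have hfirst (i : Fin 4) : partialD i (fun y => f y * g y) =
      fun y => f y * partialD i g y + partialD i f y * g y := funext fun y =>
    partialD_mul (differentiableAt_of_contDiff hf y) (differentiableAt_of_contDiff hg y)
  have hsecond (i : Fin 4) : partialD i (partialD i fun y => f y * g y) x =
      f x * partialD i (partialD i g) x + 2 * (partialD i f x * partialD i g x)
        + partialD i (partialD i f) x * g x := by
    have hf' := contDiff_partialD i hf
    have hg' := contDiff_partialD i hg
    rw [hfirst, partialD_add (differentiableAt_of_contDiff (hf.mul hg') x)
        (differentiableAt_of_contDiff (hf'.mul hg) x),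
      partialD_mul (differentiableAt_of_contDiff hf x) (differentiableAt_of_contDiff hg' x),
      partialD_mul (differentiableAt_of_contDiff hf' x) (differentiableAt_of_contDiff hg x)]
    ring
  rw [lap_eq_sum (contDiffAt_two_of_contDiff (hf.mul hg) x),
    lap_eq_sum (contDiffAt_two_of_contDiff hf x), lap_eq_sum (contDiffAt_two_of_contDiff hg x)]
  simp only [hsecond, Finset.sum_add_distrib, Finset.mul_sum, Finset.sum_mul]

lemma partialD_comp_one_sub_norm_sq {χ : ℝ → ℝ} (i : Fin 4)
    (hχ : DifferentiableAt ℝ χ (1 - ‖x‖ ^ 2)) :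
    partialD i (fun y => χ (1 - ‖y‖ ^ 2)) x = -2 * (x i * deriv χ (1 - ‖x‖ ^ 2)) := by
  rw [partialD, (hasFDerivAt_comp_one_sub_norm_sq hχ.hasDerivAt).fderiv]
  simp only [neg_mul, neg_smul, neg_apply, smul_apply, coe_innerSL_apply,
    EuclideanSpace.inner_single_right, Real.ringHom_apply, one_mul, smul_eq_mul, neg_inj]
  ring

lemma lap_comp_one_sub_norm_sq {χ : ℝ → ℝ} (hχ : ContDiff ℝ ∞ χ) (x : E4) :
    lap (fun y => χ (1 - ‖y‖ ^ 2)) x =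
      4 * ‖x‖ ^ 2 * deriv (deriv χ) (1 - ‖x‖ ^ 2) - 8 * deriv χ (1 - ‖x‖ ^ 2) := by
  have hχ' : ContDiff ℝ ∞ (deriv χ) := (contDiff_infty_iff_deriv.1 hχ).2
  have hc (i : Fin 4) : DifferentiableAt ℝ (fun y : E4 => y i) x :=
    differentiableAt_of_contDiff (contDiff_coord i) x
  have hd : DifferentiableAt ℝ (fun y : E4 => deriv χ (1 - ‖y‖ ^ 2)) x :=
    differentiableAt_of_contDiff (contDiff_comp_one_sub_norm_sq hχ') x
  have hfirst (i : Fin 4) : partialD i (fun y : E4 => χ (1 - ‖y‖ ^ 2)) =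
      fun y => -2 * (y i * deriv χ (1 - ‖y‖ ^ 2)) := funext fun y =>
    partialD_comp_one_sub_norm_sq i (hχ.differentiable (by simp) _)
  have hsecond (i : Fin 4) : partialD i (partialD i fun y : E4 => χ (1 - ‖y‖ ^ 2)) x =
      4 * deriv (deriv χ) (1 - ‖x‖ ^ 2) * x i ^ 2 - 2 * deriv χ (1 - ‖x‖ ^ 2) := by
    rw [hfirst, partialD_mul (differentiableAt_const _) ((hc i).fun_mul hd),
      partialD_mul (hc i) hd, partialD_coord, partialD_const, if_pos rfl,
      partialD_comp_one_sub_norm_sq i (hχ'.differentiable (by simp) _)]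
    ring
  rw [lap_eq_sum (contDiffAt_two_of_contDiff (contDiff_comp_one_sub_norm_sq hχ) x)]
  simp only [hsecond, Finset.sum_sub_distrib, ← Finset.mul_sum, ← EuclideanSpace.real_norm_sq_eq,
    Finset.sum_const, Finset.card_univ, Fintype.card_fin, nsmul_eq_mul]
  push_cast
  ring

lemma lap_comp_one_sub_norm_sq_mul {χ : ℝ → ℝ} (hχ : ContDiff ℝ ∞ χ) (hf : ContDiff ℝ ∞ f)
    (x : E4) :
    lap (fun y => χ (1 - ‖y‖ ^ 2) * f y) x =
      χ (1 - ‖x‖ ^ 2) * lap f x - deriv χ (1 - ‖x‖ ^ 2) * (4 * normalD f x + 8 * f x) +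
        deriv (deriv χ) (1 - ‖x‖ ^ 2) * (4 * ‖x‖ ^ 2 * f x) := by
  have hsum : ∑ i, partialD i (fun y : E4 => χ (1 - ‖y‖ ^ 2)) x * partialD i f x =
      -2 * deriv χ (1 - ‖x‖ ^ 2) * normalD f x := by
    rw [normalD_eq_sum, Finset.mul_sum]
    refine Finset.sum_congr rfl fun i _ => ?_
    rw [partialD_comp_one_sub_norm_sq i (hχ.differentiable (by simp) _)]
    ring
  rw [lap_mul (contDiff_comp_one_sub_norm_sq hχ) hf, hsum, lap_comp_one_sub_norm_sq hχ]
  ring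

end Calculus

section SphereIntegral

lemma integrable_sphere {f : E4 → ℝ} (hf : Continuous f) :
    Integrable (fun x : S3 => f x) sphereMeasure :=
  (hf.comp continuous_subtype_val).integrable_of_hasCompactSupport (.of_compactSpace _)

lemma integral_ball_partialD {f : E4 → ℝ} (hf : ContDiff ℝ ∞ f) (i : Fin 4) :
    ∫ x, partialD i f x ∂ballMeasure = ∫ x : S3, f x * (x : E4) i ∂sphereMeasure := by
  simpa [partialD, EuclideanSpace.inner_single_right] using
    setIntegral_ball_fderiv (μ := volume) (hf.of_le (by simp)) (EuclideanSpace.single i (1 : ℝ))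

end SphereIntegral

/-! ### Rotation fields and the Laplace–Beltrami operator -/

/-- The derivative along the rotation field `x_i ∂_j - x_j ∂_i`. On the sphere these fields are
tangential and divergence-free, and half the sum of their squares is `Δ_{S³}`. -/
noncomputable def rot (i j : Fin 4) (f : E4 → ℝ) (x : E4) : ℝ :=
  x i * partialD j f x - x j * partialD i f x

section Rotation

variable {f g : E4 → ℝ} {x : E4}

lemma contDiff_rot (i j : Fin 4) (hf : ContDiff ℝ ∞ f) : ContDiff ℝ ∞ (rot i j f) :=
  ((contDiff_coord i).mul (contDiff_partialD j hf)).sub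
    ((contDiff_coord j).mul (contDiff_partialD i hf))

lemma rot_congr {i j : Fin 4} (h : f =ᶠ[nhds x] g) : rot i j f x = rot i j g x := by
  simp only [rot, partialD_congr h]

lemma rot_mul (i j : Fin 4) (hf : DifferentiableAt ℝ f x) (hg : DifferentiableAt ℝ g x) :
    rot i j (fun y => f y * g y) x = f x * rot i j g x + rot i j f x * g x := by
  simp only [rot, partialD_mul hf hg]
  ring

lemma rot_eq_fderiv (i j : Fin 4) (f : E4 → ℝ) (x : E4) :
    rot i j f x = fderiv ℝ f x
      (x i • EuclideanSpace.single j (1 : ℝ) - x j • EuclideanSpace.single i (1 : ℝ)) := by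
  simp only [rot, partialD, map_sub, map_smul, smul_eq_mul]

lemma integral_sphere_rot (i j : Fin 4) (hf : ContDiff ℝ ∞ f) :
    ∫ x : S3, rot i j f x ∂sphereMeasure = 0 := by
  have hint (i j : Fin 4) :
      Integrable (fun x : S3 => partialD j f x * (x : E4) i) sphereMeasure :=
    integrable_sphere (f := fun x => partialD j f x * x i)
      ((continuous_partialD j hf).mul (contDiff_coord i (n := 0)).continuous)
  have hrot (x : S3) : rot i j f x =
      partialD j f x * (x : E4) i - partialD i f x * (x : E4) j := by
    rw [rot, mul_comm, mul_comm ((x : E4) j)]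
  simp only [hrot]
  rw [integral_sub (hint i j) (hint j i), ← integral_ball_partialD (contDiff_partialD j hf) i,
    ← integral_ball_partialD (contDiff_partialD i hf) j]
  simp only [partialD_comm (contDiffAt_two_of_contDiff hf _) i j, sub_self]

lemma integral_sphere_mul_rot (i j : Fin 4) (hf : ContDiff ℝ ∞ f) (hg : ContDiff ℝ ∞ g) :
    ∫ x : S3, f x * rot i j g x ∂sphereMeasure = -∫ x : S3, rot i j f x * g x ∂sphereMeasure := by
  have h := integral_sphere_rot i j (hf.mul hg)
  simp only [rot_mul i j (differentiableAt_of_contDiff hf _)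
    (differentiableAt_of_contDiff hg _)] at h
  rw [integral_add (integrable_sphere (hf.mul (contDiff_rot i j hg)).continuous)
    (integrable_sphere ((contDiff_rot i j hf).mul hg).continuous)] at h
  exact eq_neg_of_add_eq_zero_left h

lemma normalD_normalD (hf : ContDiffAt ℝ 2 f x) :
    normalD (normalD f) x =
      normalD f x + ∑ i, ∑ j, x i * (x j * partialD i (partialD j f) x) := by
  have hc (j : Fin 4) : DifferentiableAt ℝ (fun y : E4 => y j) x :=
    differentiableAt_of_contDiff (contDiff_coord j) x
  rw [normalD_eq_sum, normalD_eq_sum, ← Finset.sum_add_distrib]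
  refine Finset.sum_congr rfl fun i _ => ?_
  rw [show normalD f = fun y => ∑ j, y j * partialD j f y from funext (normalD_eq_sum f),
    partialD_sum fun j _ => (hc j).fun_mul (differentiableAt_partialD j hf)]
  simp only [partialD_mul (hc _) (differentiableAt_partialD _ hf), partialD_coord, ite_mul, one_mul,
    zero_mul, Finset.sum_add_distrib, Finset.sum_ite_eq, Finset.mem_univ, if_true, mul_add,
    Finset.mul_sum]
  ring

lemma rot_rot (i j : Fin 4) (hf : ContDiffAt ℝ 2 f x) :
    rot i j (rot i j f) x =
      x i ^ 2 * partialD j (partialD j f) x + x j ^ 2 * partialD i (partialD i f) x -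
        x i * (x j * partialD i (partialD j f) x) - x j * (x i * partialD j (partialD i f) x) -
        x i * partialD i f x - x j * partialD j f x +
        2 * (if i = j then x i * partialD i f x else 0) := by
  have hc (j : Fin 4) : DifferentiableAt ℝ (fun y : E4 => y j) x :=
    differentiableAt_of_contDiff (contDiff_coord j) x
  have hd (j : Fin 4) : DifferentiableAt ℝ (partialD j f) x := differentiableAt_partialD j hf
  have hpartial (k : Fin 4) : partialD k (rot i j f) x =
      x i * partialD k (partialD j f) x + (if k = i then 1 else 0) * partialD j f x -
        (x j * partialD k (partialD i f) x + (if k = j then 1 else 0) * partialD i f x) := by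
    rw [show rot i j f = fun y => y i * partialD j f y - y j * partialD i f y from rfl,
      partialD_sub ((hc i).fun_mul (hd j)) ((hc j).fun_mul (hd i)), partialD_mul (hc i) (hd j),
      partialD_mul (hc j) (hd i), partialD_coord, partialD_coord]
  rw [show rot i j (rot i j f) x =
    x i * partialD j (rot i j f) x - x j * partialD i (rot i j f) x from rfl, hpartial, hpartial]
  rcases eq_or_ne i j with rfl | hij
  · simp only [if_true]; ring
  · simp only [if_true, if_neg hij, if_neg hij.symm]; ring

lemma sum_rot_rot (hf : ContDiffAt ℝ 2 f x) :
    ∑ i, ∑ j, rot i j (rot i j f) x =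
      2 * (‖x‖ ^ 2 * lap f x - normalD (normalD f) x - 2 * normalD f x) := by
  have hcomm : ∑ i, ∑ j, x j * (x i * partialD j (partialD i f) x) =
      ∑ i, ∑ j, x i * (x j * partialD i (partialD j f) x) := Finset.sum_comm
  rw [normalD_normalD hf, lap_eq_sum hf, EuclideanSpace.real_norm_sq_eq, normalD_eq_sum]
  simp only [rot_rot _ _ hf, Finset.sum_add_distrib, Finset.sum_sub_distrib, hcomm,
    Finset.sum_ite_eq, Finset.mem_univ, if_true, Finset.sum_const, Finset.card_univ,
    Fintype.card_fin, nsmul_eq_mul, ← Finset.mul_sum, ← Finset.sum_mul]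
  push_cast
  ring

end Rotation

section RadialExtension

variable {f : E4 → ℝ} {x : E4}

/-- The extension of `f|_{S³}` to `ℝ⁴ ∖ {0}` that is constant along rays. -/
noncomputable def radialExt (f : E4 → ℝ) (x : E4) : ℝ := f (‖x‖⁻¹ • x)

lemma ne_zero_of_mem_sphere (hx : x ∈ sphere (0 : E4) 1) : x ≠ 0 :=
  ne_of_mem_sphere hx one_ne_zero

lemma contDiffAt_radialExt (hf : ContDiff ℝ ∞ f) (hx : x ≠ 0) : ContDiffAt ℝ 2 (radialExt f) x :=
  ContDiffAt.comp x (contDiffAt_two_of_contDiff hf _)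
    (((contDiffAt_norm ℝ hx).inv (norm_ne_zero_iff.mpr hx)).smul contDiffAt_id)

lemma hasFDerivAt_inv_norm (hx : x ≠ 0) :
    HasFDerivAt (fun y : E4 => ‖y‖⁻¹) (-(‖x‖⁻¹ ^ 3) • innerSL ℝ x) x := by
  have hnorm : ‖x‖ ≠ 0 := norm_ne_zero_iff.2 hx
  have hsqrt := (hasFDerivAt_id x).norm_sq.sqrt (pow_ne_zero 2 hnorm)
  simp only [id, Real.sqrt_sq (norm_nonneg _)] at hsqrt
  refine ((hasDerivAt_inv hnorm).comp_hasFDerivAt x hsqrt).congr_fderiv ?_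
  ext v
  simp only [one_div, mul_inv_rev, ContinuousLinearMap.comp_id, neg_smul, neg_apply, smul_apply,
    coe_innerSL_apply, nsmul_eq_mul, Nat.cast_ofNat, smul_eq_mul, inv_pow, neg_inj]
  field_simp

lemma fderiv_radialExt_apply (hf : ContDiff ℝ ∞ f) (hx : x ≠ 0) (v : E4) :
    fderiv ℝ (radialExt f) x v =
      fderiv ℝ f (‖x‖⁻¹ • x) (‖x‖⁻¹ • v - (‖x‖⁻¹ ^ 3 * inner ℝ x v) • x) := by
  have hcomp : HasFDerivAt (radialExt f) _ x :=
    HasFDerivAt.comp (f := fun y : E4 => ‖y‖⁻¹ • y) x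
      (differentiableAt_of_contDiff hf (‖x‖⁻¹ • x)).hasFDerivAt
      ((hasFDerivAt_inv_norm hx).smul (hasFDerivAt_id x))
  rw [hcomp.fderiv]
  simp [sub_eq_add_neg]

lemma normalD_radialExt (hf : ContDiff ℝ ∞ f) (hx : x ≠ 0) : normalD (radialExt f) x = 0 := by
  have hnorm : ‖x‖⁻¹ ^ 3 * ‖x‖ ^ 2 = ‖x‖⁻¹ := by
    have := norm_ne_zero_iff.2 hx
    field_simp
  rw [normalD, fderiv_radialExt_apply hf hx, real_inner_self_eq_norm_sq, hnorm, sub_self, map_zero]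

lemma rot_radialExt (i j : Fin 4) (hf : ContDiff ℝ ∞ f) (hx : x ≠ 0) :
    rot i j (radialExt f) x = radialExt (rot i j f) x := by
  have htangent : inner ℝ x
      (x i • EuclideanSpace.single j (1 : ℝ) - x j • EuclideanSpace.single i (1 : ℝ)) = 0 := by
    simp [inner_sub_right, inner_smul_right, EuclideanSpace.inner_single_right, mul_comm]
  rw [rot_eq_fderiv, fderiv_radialExt_apply hf hx, htangent, radialExt, rot_eq_fderiv]
  simp [smul_sub, smul_smul]

end RadialExtension

section SphereLaplacian

variable {f g : E4 → ℝ} {x : E4}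

lemma sphereLap_eq_sum_rot_rot (hf : ContDiff ℝ ∞ f) (hx : x ∈ sphere (0 : E4) 1) :
    sphereLap f x = (1 / 2) * ∑ i, ∑ j, rot i j (rot i j f) x := by
  have hx0 := ne_zero_of_mem_sphere hx
  have hx1 : ‖x‖ = 1 := mem_sphere_zero_iff_norm.1 hx
  have hne : ∀ᶠ y in nhds x, y ≠ 0 := isOpen_ne.mem_nhds hx0
  have hnormal : normalD (normalD (radialExt f)) x = 0 := by
    have hzero : normalD (radialExt f) =ᶠ[nhds x] fun _ => 0 :=
      hne.mono fun y hy => normalD_radialExt hf hy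
    rw [normalD, hzero.fderiv_eq, fderiv_fun_const, Pi.zero_apply, zero_apply]
  have hrot (i j : Fin 4) : rot i j (rot i j (radialExt f)) x = rot i j (rot i j f) x := by
    have hext : rot i j (radialExt f) =ᶠ[nhds x] radialExt (rot i j f) :=
      hne.mono fun y hy => rot_radialExt i j hf hy
    rw [rot_congr hext, rot_radialExt i j (contDiff_rot i j hf) hx0, radialExt, hx1, inv_one,
      one_smul]
  have hsum := sum_rot_rot (contDiffAt_radialExt hf hx0)
  simp only [hrot, hnormal, normalD_radialExt hf hx0, hx1] at hsum
  rw [hsum, show sphereLap f x = lap (radialExt f) x from rfl]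
  ring

lemma sphereLap_eq (hf : ContDiff ℝ ∞ f) (hx : x ∈ sphere (0 : E4) 1) :
    sphereLap f x = lap f x - normalD (normalD f) x - 2 * normalD f x := by
  rw [sphereLap_eq_sum_rot_rot hf hx, sum_rot_rot (contDiffAt_two_of_contDiff hf x),
    mem_sphere_zero_iff_norm.1 hx]
  ring

lemma sphereLap_congr (h : EqOn f g (sphere 0 1)) : EqOn (sphereLap f) (sphereLap g) {0}ᶜ := by
  intro x hx
  have hext : (fun y : E4 => f (‖y‖⁻¹ • y)) =ᶠ[nhds x] fun y => g (‖y‖⁻¹ • y) := by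
    filter_upwards [isOpen_ne.mem_nhds hx] with y hy
    exact h (by simp [norm_smul, norm_ne_zero_iff.2 hy])
  exact (InnerProductSpace.laplacian_congr_nhds hext).eq_of_nhds

lemma integral_sphere_mul_sphereLap (hf : ContDiff ℝ ∞ f) (hg : ContDiff ℝ ∞ g) :
    ∫ x : S3, f x * sphereLap g x ∂sphereMeasure =
      -((1 / 2) * ∑ i, ∑ j, ∫ x : S3, rot i j f x * rot i j g x ∂sphereMeasure) := by
  have hint (i j : Fin 4) :
      Integrable (fun x : S3 => f x * rot i j (rot i j g) x) sphereMeasure :=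
    integrable_sphere (f := fun x => f x * rot i j (rot i j g) x)
      (hf.mul (contDiff_rot i j (contDiff_rot i j hg))).continuous
  calc ∫ x : S3, f x * sphereLap g x ∂sphereMeasure
      = ∫ x : S3, (1 / 2) * ∑ i, ∑ j, f x * rot i j (rot i j g) x ∂sphereMeasure :=
        integral_congr_ae (.of_forall fun x => by
          simp only [sphereLap_eq_sum_rot_rot hg x.2, ← Finset.mul_sum]; ring)
    _ = (1 / 2) * ∑ i, ∑ j, ∫ x : S3, f x * rot i j (rot i j g) x ∂sphereMeasure := by
        rw [integral_const_mul,
          integral_finsetSum _ fun i _ => integrable_finsetSum _ fun j _ => hint i j]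
        simp only [integral_finsetSum _ fun j _ => hint _ j]
    _ = -((1 / 2) * ∑ i, ∑ j, ∫ x : S3, rot i j f x * rot i j g x ∂sphereMeasure) := by
        simp only [integral_sphere_mul_rot _ _ hf (contDiff_rot _ _ hg), Finset.sum_neg_distrib,
          mul_neg]

lemma integral_sphere_sphereLap_comm (hf : ContDiff ℝ ∞ f) (hg : ContDiff ℝ ∞ g) :
    ∫ x : S3, f x * sphereLap g x ∂sphereMeasure =
      ∫ x : S3, sphereLap f x * g x ∂sphereMeasure := by
  simp only [mul_comm (sphereLap f _), integral_sphere_mul_sphereLap hf hg,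
    integral_sphere_mul_sphereLap hg hf, mul_comm (rot _ _ g _)]

end SphereLaplacian

/-! ### Harmonic polynomials -/

section HarmonicPolynomials

open MvPolynomial

section Laplacian

variable (σ R : Type*) [Fintype σ] [CommRing R]

/-- The Laplacian on polynomials. -/
noncomputable def polyLap : MvPolynomial σ R →ₗ[R] MvPolynomial σ R :=
  ∑ i, (pderiv i).toLinearMap ∘ₗ (pderiv i).toLinearMap

/-- The polynomial `|x|²`. -/
noncomputable def sumSq : MvPolynomial σ R := ∑ i, X i ^ 2

/-- Homogeneous harmonic polynomials of degree `k`, in any number of variables. -/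
noncomputable def harmonicSubmodule (k : ℕ) : Submodule R (MvPolynomial σ R) :=
  homogeneousSubmodule σ R k ⊓ LinearMap.ker (polyLap σ R)

/-- The span of the products `|x|^{2m} q` of degree `k` with `q` harmonic and homogeneous, the
right-hand side of Fischer's decomposition of the homogeneous polynomials. -/
noncomputable def fischerSubmodule (k : ℕ) : Submodule R (MvPolynomial σ R) :=
  Submodule.span R
    {p | ∃ m j, 2 * m + j = k ∧ ∃ q ∈ harmonicSubmodule σ R j, p = sumSq σ R ^ m * q}

variable {σ R}

lemma polyLap_apply (p : MvPolynomial σ R) : polyLap σ R p = ∑ i, pderiv i (pderiv i p) := by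
  simp [polyLap]

lemma isHomogeneous_sumSq : (sumSq σ R).IsHomogeneous 2 :=
  IsHomogeneous.sum _ _ _ fun i _ => isHomogeneous_X_pow i 2

lemma pderiv_sumSq (i : σ) : pderiv i (sumSq σ R) = 2 * X i := by
  classical
  rw [sumSq, map_sum, Finset.sum_eq_single_of_mem i (Finset.mem_univ i)]
  · simp [Derivation.leibniz_pow, nsmul_eq_mul]
  · intro j _ hj
    simp [Derivation.leibniz_pow, pderiv_X_of_ne hj]

lemma polyLap_sumSq_mul {p : MvPolynomial σ R} {d : ℕ} (hp : p.IsHomogeneous d) :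
    polyLap σ R (sumSq σ R * p) =
      (2 * Fintype.card σ + 4 * d : R) • p + sumSq σ R * polyLap σ R p := by
  have hsecond (i : σ) : pderiv i (pderiv i (sumSq σ R * p)) =
      2 * p + 4 * (X i * pderiv i p) + sumSq σ R * pderiv i (pderiv i p) := by
    have htwo : pderiv i (2 : MvPolynomial σ R) = 0 := pderiv_C (a := (2 : R))
    simp only [pderiv_mul, pderiv_sumSq, map_add, pderiv_X_self, htwo]
    ring
  simp only [polyLap_apply, hsecond, Finset.sum_add_distrib, ← Finset.mul_sum,
    hp.sum_X_mul_pderiv, Finset.sum_const, Finset.card_univ, nsmul_eq_mul, smul_eq_C_mul,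
    map_add, map_mul, map_natCast, map_ofNat]
  ring

lemma isHomogeneous_polyLap {p : MvPolynomial σ R} {d : ℕ} (hp : p.IsHomogeneous d) :
    (polyLap σ R p).IsHomogeneous (d - 2) := by
  rw [polyLap_apply]
  exact IsHomogeneous.sum _ _ _ fun i _ => hp.pderiv.pderiv

lemma homogeneousSubmodule_le_ker_polyLap {d : ℕ} (hd : d ≤ 1) :
    homogeneousSubmodule σ R d ≤ LinearMap.ker (polyLap σ R) := fun p hp => by
  rw [LinearMap.mem_ker, polyLap_apply]
  refine Finset.sum_eq_zero fun i _ => ?_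
  have hconst := IsHomogeneous.pderiv (i := i) hp
  rw [Nat.sub_eq_zero_of_le hd, ← totalDegree_zero_iff_isHomogeneous,
    totalDegree_eq_zero_iff_eq_C] at hconst
  rw [hconst, pderiv_C]

lemma polyLap_sumSq_pow_mul {q : MvPolynomial σ R} {j : ℕ} (hq : q ∈ harmonicSubmodule σ R j)
    (m : ℕ) : polyLap σ R (sumSq σ R ^ (m + 1) * q) =
      (2 * (m + 1) * (Fintype.card σ + 2 * m + 2 * j) : R) • (sumSq σ R ^ m * q) := by
  induction m with
  | zero =>
    rw [zero_add, pow_one, polyLap_sumSq_mul hq.1, LinearMap.mem_ker.1 hq.2, mul_zero, add_zero,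
      pow_zero, one_mul, Nat.cast_zero]
    ring_nf
  | succ m ih =>
    have hdeg : (sumSq σ R ^ (m + 1) * q).IsHomogeneous (2 * (m + 1) + j) :=
      (isHomogeneous_sumSq.pow _).mul hq.1
    rw [pow_succ' _ (m + 1), mul_assoc, polyLap_sumSq_mul hdeg, ih, mul_smul_comm, ← mul_assoc,
      ← pow_succ', ← add_smul]
    push_cast
    ring_nf

lemma fischerSubmodule_le (k : ℕ) : fischerSubmodule σ R k ≤ homogeneousSubmodule σ R k := by
  refine Submodule.span_le.2 ?_
  rintro _ ⟨m, j, rfl, q, hq, rfl⟩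
  exact (isHomogeneous_sumSq.pow _).mul hq.1

lemma map_sumSq_mul_fischerSubmodule_le (k : ℕ) :
    (fischerSubmodule σ R k).map (LinearMap.mulLeft R (sumSq σ R)) ≤
      fischerSubmodule σ R (k + 2) := by
  refine (Submodule.map_span_le _ _ _).2 ?_
  rintro _ ⟨m, j, hk, q, hq, rfl⟩
  refine Submodule.subset_span ⟨m + 1, j, by omega, q, hq, ?_⟩
  rw [LinearMap.mulLeft_apply, pow_succ', mul_assoc]

end Laplacian

section Fischer

variable {σ K : Type*} [Fintype σ] [Nonempty σ] [Field K] [CharZero K]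

variable (σ K) in
lemma sumSq_pow_mul_coeff_ne_zero (m j : ℕ) :
    (2 * (m + 1) * (Fintype.card σ + 2 * m + 2 * j) : K) ≠ 0 := by
  have : 2 * (m + 1) * (Fintype.card σ + 2 * m + 2 * j) ≠ 0 := by
    have := Fintype.card_pos (α := σ)
    positivity
  exact_mod_cast this

lemma fischerSubmodule_le_map_polyLap (k : ℕ) :
    fischerSubmodule σ K k ≤
      (fischerSubmodule σ K k).map (polyLap σ K ∘ₗ LinearMap.mulLeft K (sumSq σ K)) := by
  refine Submodule.span_le.2 ?_
  rintro _ ⟨m, j, hk, q, hq, rfl⟩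
  refine ⟨(2 * (m + 1) * (Fintype.card σ + 2 * m + 2 * j) : K)⁻¹ • (sumSq σ K ^ m * q),
    Submodule.smul_mem _ _ (Submodule.subset_span ⟨m, j, hk, q, hq, rfl⟩), ?_⟩
  rw [map_smul, LinearMap.comp_apply, LinearMap.mulLeft_apply, ← mul_assoc, ← pow_succ',
    polyLap_sumSq_pow_mul hq, inv_smul_smul₀ (sumSq_pow_mul_coeff_ne_zero σ K m j)]

theorem fischerSubmodule_eq_homogeneousSubmodule (k : ℕ) :
    fischerSubmodule σ K k = homogeneousSubmodule σ K k := by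
  refine le_antisymm (fischerSubmodule_le k) ?_
  induction k using Nat.strong_induction_on with
  | _ k ih =>
    intro p hp
    have harmonic_mem {q : MvPolynomial σ K} (hq : q ∈ harmonicSubmodule σ K k) :
        q ∈ fischerSubmodule σ K k :=
      Submodule.subset_span ⟨0, k, by omega, q, hq, by rw [pow_zero, one_mul]⟩
    rcases lt_or_ge k 2 with hk | hk
    · exact harmonic_mem ⟨hp, homogeneousSubmodule_le_ker_polyLap (by omega) hp⟩
    · obtain ⟨d, rfl⟩ := Nat.exists_eq_add_of_le' hk
      obtain ⟨s, hs, hlap⟩ := fischerSubmodule_le_map_polyLap d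
        (ih d (by omega) (isHomogeneous_polyLap hp))
      have hmul := map_sumSq_mul_fischerSubmodule_le d (Submodule.mem_map_of_mem hs)
      have hsub : p - sumSq σ K * s ∈ harmonicSubmodule σ K (d + 2) :=
        ⟨Submodule.sub_mem _ hp (fischerSubmodule_le _ hmul), LinearMap.mem_ker.2 <| by
          rw [map_sub, sub_eq_zero]; exact hlap.symm⟩
      exact sub_add_cancel p (sumSq σ K * s) ▸ Submodule.add_mem _ (harmonic_mem hsub) hmul

lemma exists_polyLap_eq {k : ℕ} {r : MvPolynomial σ K} (hr : r.IsHomogeneous k) :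
    ∃ p : MvPolynomial σ K, p.IsHomogeneous (k + 2) ∧ polyLap σ K p = r := by
  obtain ⟨s, hs, rfl⟩ := fischerSubmodule_le_map_polyLap k
    ((fischerSubmodule_eq_homogeneousSubmodule k).ge hr)
  exact ⟨_, fischerSubmodule_le _
    (map_sumSq_mul_fischerSubmodule_le k (Submodule.mem_map_of_mem hs)), rfl⟩

theorem polyLap_surjective : Function.Surjective (polyLap σ K) := by
  refine LinearMap.range_eq_top.1 (eq_top_iff.2 fun p _ => ?_)
  rw [← sum_homogeneousComponent p]
  refine Submodule.sum_mem _ fun k _ => ?_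
  obtain ⟨q, -, hq⟩ := exists_polyLap_eq (homogeneousComponent_isHomogeneous k p)
  exact ⟨q, hq⟩

theorem span_sumSq_pow_mul_harmonic_eq_top :
    Submodule.span K {p | ∃ m j, ∃ q ∈ harmonicSubmodule σ K j, p = sumSq σ K ^ m * q} = ⊤ := by
  refine eq_top_iff.2 fun p _ => ?_
  rw [← sum_homogeneousComponent p]
  refine Submodule.sum_mem _ fun k _ => ?_
  have hk := (fischerSubmodule_eq_homogeneousSubmodule (σ := σ) (K := K) k).ge
    (homogeneousComponent_isHomogeneous k p)
  refine Submodule.span_mono ?_ hk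
  rintro _ ⟨m, j, -, q, hq, rfl⟩
  exact ⟨m, j, q, hq, rfl⟩

theorem eq_zero_of_polyLap_one_sub_sumSq_sq_mul (L : MvPolynomial σ K →ₗ[K] K)
    (hL : ∀ p, L (polyLap σ K ((1 - sumSq σ K) ^ 2 * p)) = 0)
    (hharm : ∀ j, ∀ q ∈ harmonicSubmodule σ K j, L q = 0) : L = 0 := by
  refine LinearMap.ext_on span_sumSq_pow_mul_harmonic_eq_top ?_
  rintro _ ⟨m, j, q, hq, rfl⟩
  rw [LinearMap.zero_apply]
  have hc (m : ℕ) : (2 * (m + 1) * (Fintype.card σ + 2 * m + 2 * j) : K) ≠ 0 :=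
    sumSq_pow_mul_coeff_ne_zero σ K m j
  have hLpow (m : ℕ) := congrArg L (polyLap_sumSq_pow_mul hq m)
  simp only [map_smul, smul_eq_mul] at hLpow
  induction m using Nat.twoStepInduction with
  | zero => rw [pow_zero, one_mul, hharm j q hq]
  | one =>
    have hexp : (1 - sumSq σ K) ^ 2 * q =
        q - (sumSq σ K ^ (0 + 1) * q + sumSq σ K ^ (0 + 1) * q) + sumSq σ K ^ (1 + 1) * q := by
      ring
    have hzero := hL q
    rw [hexp, map_add, map_sub, map_add, LinearMap.mem_ker.1 hq.2, map_add, map_sub, map_add,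
      hLpow, hLpow, pow_zero, one_mul, hharm j q hq] at hzero
    exact (mul_eq_zero.1 (by simpa using hzero)).resolve_left (by simpa using hc 1)
  | more m hm hm1 =>
    have hexp : (1 - sumSq σ K) ^ 2 * (sumSq σ K ^ (m + 1) * q) =
        sumSq σ K ^ (m + 1) * q - (sumSq σ K ^ (m + 1 + 1) * q + sumSq σ K ^ (m + 1 + 1) * q) +
          sumSq σ K ^ (m + 2 + 1) * q := by
      ring
    have hzero := hL (sumSq σ K ^ (m + 1) * q)
    rw [hexp, map_add, map_sub, map_add, map_add, map_sub, map_add, hLpow, hLpow, hLpow, hm,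
      hm1, mul_zero, mul_zero, add_zero, sub_zero, zero_add] at hzero
    exact (mul_eq_zero.1 hzero).resolve_left (hc (m + 2))

end Fischer

section Dimension

variable (σ K : Type*) [Field K]

instance [Finite σ] (k : ℕ) : FiniteDimensional K (homogeneousSubmodule σ K k) :=
  .of_fg (homogeneousSubmodule_fg σ K k)

variable [Fintype σ]

instance (k : ℕ) : FiniteDimensional K (harmonicSubmodule σ K k) :=
  Submodule.finiteDimensional_of_le inf_le_left

lemma finrank_homogeneousSubmodule (k : ℕ) :
    Module.finrank K (homogeneousSubmodule σ K k) = (Fintype.card σ + k - 1).choose k := by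
  classical
  have hset : {d : σ →₀ ℕ | d.degree = k} = ↑((Finset.univ : Finset σ).finsuppAntidiag k) := by
    ext d
    simp [Finset.mem_finsuppAntidiag, Finsupp.degree_eq_sum]
  rw [homogeneousSubmodule_eq_finsupp_supported, hset,
    (AddMonoidAlgebra.supportedEquivFinsupp _).finrank_eq, Module.finrank_finsupp_self,
    ← Nat.card_eq_fintype_card, Nat.card_coe_set_eq, Set.ncard_coe_finset,
    Finset.card_finsuppAntidiag_nat_eq_choose, Finset.card_univ]

lemma finrank_harmonicSubmodule_add [Nonempty σ] [CharZero K] (k : ℕ) :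
    Module.finrank K (harmonicSubmodule σ K (k + 2)) +
        Module.finrank K (homogeneousSubmodule σ K k) =
      Module.finrank K (homogeneousSubmodule σ K (k + 2)) := by
  set L := (polyLap σ K).domRestrict (homogeneousSubmodule σ K (k + 2))
  have hrange : LinearMap.range L = homogeneousSubmodule σ K k := by
    refine le_antisymm ?_ fun r hr => ?_
    · rintro _ ⟨p, rfl⟩
      exact isHomogeneous_polyLap p.2
    · obtain ⟨p, hp, rfl⟩ := exists_polyLap_eq hr
      exact ⟨⟨p, hp⟩, rfl⟩
  have hker : (LinearMap.ker L).map (Submodule.subtype _) = harmonicSubmodule σ K (k + 2) := by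
    ext p
    simp [harmonicSubmodule, L, and_comm]
  rw [← hker, Submodule.finrank_map_subtype_eq, ← hrange, add_comm,
    LinearMap.finrank_range_add_finrank_ker]

end Dimension

lemma coe_harmonicSubmodule (k : ℕ) :
    (harmonicSubmodule (Fin 4) ℝ k : Set (MvPolynomial (Fin 4) ℝ)) = harmonicPolynomials k := by
  ext p
  simp [harmonicSubmodule, harmonicPolynomials, polyLap_apply]

theorem finrank_harmonicSubmodule_four (k : ℕ) :
    Module.finrank ℝ (harmonicSubmodule (Fin 4) ℝ k) = (k + 1) ^ 2 := by
  rcases lt_or_ge k 2 with hk | hk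
  · rw [harmonicSubmodule, inf_eq_left.2 (homogeneousSubmodule_le_ker_polyLap (by omega)),
      finrank_homogeneousSubmodule]
    interval_cases k <;> rfl
  · obtain ⟨d, rfl⟩ := Nat.exists_eq_add_of_le' hk
    have hdim := finrank_harmonicSubmodule_add (Fin 4) ℝ d
    simp only [finrank_homogeneousSubmodule, Fintype.card_fin] at hdim
    have hchoose (n : ℕ) : 6 * (4 + n - 1).choose n = (n + 3) * (n + 2) * (n + 1) := by
      rw [show 4 + n - 1 = n + 3 by omega, Nat.choose_symm_add, show 6 = Nat.factorial 3 from rfl,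
        ← Nat.descFactorial_eq_factorial_mul_choose]
      simp only [Nat.descFactorial_succ, Nat.reduceSubDiff, Nat.add_one_sub_one, tsub_zero,
        Nat.descFactorial_zero, mul_one]
      ring
    have h2 := hchoose (d + 2)
    have h0 := hchoose d
    nlinarith

end HarmonicPolynomials

section PolynomialFunctions

/-- The function on `ℝ⁴` defined by a polynomial, as an algebra homomorphism. -/
noncomputable def polyMap : MvPolynomial (Fin 4) ℝ →ₐ[ℝ] C(E4, ℝ) :=
  MvPolynomial.aeval fun i => ⟨fun x => x i, (contDiff_coord i (n := 0)).continuous⟩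

variable {p q : MvPolynomial (Fin 4) ℝ} {k : ℕ}

lemma polyMap_X_apply (i : Fin 4) (x : E4) : polyMap (.X i) x = x i := by
  rw [polyMap, MvPolynomial.aeval_X, ContinuousMap.coe_mk]

lemma polyMap_C (a : ℝ) : polyMap (.C a) = .const E4 a := MvPolynomial.aeval_C _ a

lemma polyMap_apply (p : MvPolynomial (Fin 4) ℝ) (x : E4) :
    polyMap p x = MvPolynomial.eval (fun i => x i) p := by
  induction p using MvPolynomial.induction_on with
  | C a => rw [polyMap_C, ContinuousMap.const_apply, MvPolynomial.eval_C]
  | add p q hp hq => rw [map_add, ContinuousMap.add_apply, hp, hq, map_add]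
  | mul_X p i hp =>
    rw [map_mul, ContinuousMap.mul_apply, hp, polyMap_X_apply, map_mul, MvPolynomial.eval_X]

lemma polyMap_sumSq_apply (x : E4) : polyMap (sumSq (Fin 4) ℝ) x = ‖x‖ ^ 2 := by
  simp [polyMap_apply, sumSq, EuclideanSpace.real_norm_sq_eq]

lemma contDiff_polyMap (p : MvPolynomial (Fin 4) ℝ) : ContDiff ℝ ∞ (polyMap p) := by
  induction p using MvPolynomial.induction_on with
  | C a =>
    rw [polyMap_C]
    exact contDiff_const
  | add p q hp hq =>
    rw [map_add]
    exact hp.add hq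
  | mul_X p i hp =>
    rw [map_mul]
    exact hp.mul (by simpa only [funext (polyMap_X_apply i)] using contDiff_coord i)

lemma partialD_polyMap (i : Fin 4) (p : MvPolynomial (Fin 4) ℝ) :
    partialD i (polyMap p) = polyMap (MvPolynomial.pderiv i p) := by
  have hdiff (p) := differentiableAt_of_contDiff (contDiff_polyMap p)
  funext x
  induction p using MvPolynomial.induction_on with
  | C a =>
    rw [polyMap_C, MvPolynomial.pderiv_C, map_zero]
    exact partialD_const i a x
  | add p q hp hq =>
    rw [map_add, map_add, map_add, ContinuousMap.add_apply, ← hp, ← hq]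
    exact partialD_add (hdiff p x) (hdiff q x)
  | mul_X p j hp =>
    have hcoord : partialD i (polyMap (.X j)) x = polyMap (MvPolynomial.pderiv i (.X j)) x := by
      rw [funext (polyMap_X_apply j), partialD_coord, MvPolynomial.pderiv_X, Pi.single_apply]
      obtain rfl | hij := eq_or_ne i j
      · simp
      · simp [hij, hij.symm]
    rw [MvPolynomial.pderiv_mul, map_add, map_mul, map_mul, map_mul, ContinuousMap.add_apply,
      ContinuousMap.mul_apply, ContinuousMap.mul_apply, ← hp, ← hcoord, add_comm]
    exact partialD_mul (hdiff p x) (hdiff (.X j) x)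

lemma lap_polyMap (p : MvPolynomial (Fin 4) ℝ) :
    lap (polyMap p) = polyMap (polyLap (Fin 4) ℝ p) := by
  funext x
  rw [lap_eq_sum (contDiffAt_two_of_contDiff (contDiff_polyMap p) x), polyLap_apply, map_sum,
    ContinuousMap.sum_apply]
  simp only [partialD_polyMap]

lemma normalD_polyMap (hp : p.IsHomogeneous k) : normalD (polyMap p) = (k : ℝ) • ⇑(polyMap p) := by
  funext x
  have heuler := congrArg (fun r => polyMap r x) hp.sum_X_mul_pderiv
  simp only [map_sum, map_mul, map_nsmul, ContinuousMap.sum_apply, ContinuousMap.mul_apply,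
    polyMap_X_apply, ← partialD_polyMap] at heuler
  rw [normalD_eq_sum, heuler]
  simp

lemma lap_polyMap_eq_zero (hq : q ∈ harmonicSubmodule (Fin 4) ℝ k) : lap (polyMap q) = 0 := by
  rw [lap_polyMap, LinearMap.mem_ker.1 hq.2, map_zero, ContinuousMap.coe_zero]

lemma eq_zero_of_eqOn_ball (h : EqOn (polyMap p) 0 (ball 0 1)) : p = 0 := by
  refine MvPolynomial.funext_set (fun _ => Ioo (-1 / 2) (1 / 2))
    (fun _ => Ioo_infinite (by norm_num)) fun v hv => ?_
  have hmem : WithLp.toLp 2 v ∈ ball (0 : E4) 1 := by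
    have hsq (i : Fin 4) : v i ^ 2 < 1 / 4 := by
      obtain ⟨hl, hr⟩ := hv i (mem_univ i)
      nlinarith
    have hnorm : ‖WithLp.toLp 2 v‖ ^ 2 < 1 := by
      rw [EuclideanSpace.real_norm_sq_eq]
      calc ∑ i, v i ^ 2 < ∑ _i : Fin 4, (1 / 4 : ℝ) :=
            Finset.sum_lt_sum_of_nonempty Finset.univ_nonempty fun i _ => hsq i
        _ = 1 := by norm_num
    exact mem_ball_zero_iff.2 ((sq_lt_one_iff₀ (norm_nonneg _)).1 hnorm)
  simpa [polyMap_apply] using h hmem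

lemma exists_polyMap_near (f : C(E4, ℝ)) {K : Set E4} (hK : IsCompact K) {ε : ℝ} (hε : 0 < ε) :
    ∃ p, ∀ x ∈ K, ‖polyMap p x - f x‖ < ε := by
  have hsep : polyMap.range.SeparatesPoints := fun x y hxy => by
    obtain ⟨i, hi⟩ : ∃ i, x i ≠ y i := by
      by_contra! h
      exact hxy (PiLp.ext h)
    exact ⟨_, ⟨polyMap (.X i), ⟨.X i, rfl⟩, rfl⟩, by simpa only [polyMap_X_apply] using hi⟩
  obtain ⟨_, ⟨p, rfl⟩, hp⟩ :=
    ContinuousMap.exists_mem_subalgebra_near_continuous_of_isCompact_of_separatesPoints hsep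
      f hK hε
  exact ⟨p, hp⟩

lemma integral_mul_comp_eq_zero_of_polyMap {α : Type*} [MeasurableSpace α] {μ : Measure α}
    {u : α → ℝ} (hu : Integrable u μ) {ι : α → E4} (hι : Measurable ι) {K : Set E4}
    (hK : IsCompact K) (hιK : ∀ᵐ x ∂μ, ι x ∈ K)
    (h : ∀ p, ∫ x, u x * polyMap p (ι x) ∂μ = 0) (f : C(E4, ℝ)) :
    ∫ x, u x * f (ι x) ∂μ = 0 := by
  have hint (g : C(E4, ℝ)) : Integrable (fun x => u x * g (ι x)) μ := by
    obtain ⟨C, hC⟩ := hK.exists_bound_of_continuousOn g.continuous.continuousOn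
    exact hu.mul_bdd (g.continuous.measurable.comp hι).aestronglyMeasurable
      (hιK.mono fun x hx => hC _ hx)
  have hbound (ε : ℝ) (hε : 0 < ε) : ‖∫ x, u x * f (ι x) ∂μ‖ ≤ (∫ x, ‖u x‖ ∂μ) * ε := by
    obtain ⟨p, hp⟩ := exists_polyMap_near f hK hε
    calc ‖∫ x, u x * f (ι x) ∂μ‖ = ‖∫ x, u x * (polyMap p (ι x) - f (ι x)) ∂μ‖ := by
          simp only [mul_sub]
          rw [integral_sub (hint _) (hint f), h p, zero_sub, norm_neg]
      _ ≤ ∫ x, ‖u x‖ * ε ∂μ := by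
          refine norm_integral_le_of_norm_le (hu.norm.mul_const ε) ?_
          filter_upwards [hιK] with x hx
          rw [norm_mul]
          exact mul_le_mul_of_nonneg_left (hp _ hx).le (norm_nonneg _)
      _ = (∫ x, ‖u x‖ ∂μ) * ε := integral_mul_const _ _
  have hlim : Filter.Tendsto (fun ε => (∫ x, ‖u x‖ ∂μ) * ε) (nhdsWithin 0 (Ioi 0)) (nhds 0) := by
    simpa using ((continuous_const_mul (∫ x, ‖u x‖ ∂μ)).tendsto 0).mono_left nhdsWithin_le_nhds
  exact norm_le_zero_iff.1 (ge_of_tendsto hlim (eventually_mem_nhdsWithin.mono hbound))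

end PolynomialFunctions

/-! ### Weak derivatives, traces and Green's formula -/

section L2Classes

lemma memLp_ball (f : C(E4, ℝ)) : MemLp f 2 ballMeasure := by
  obtain ⟨C, hC⟩ := (isCompact_closedBall (0 : E4) 1).exists_bound_of_continuousOn
    f.continuous.continuousOn
  refine .of_bound f.continuous.aestronglyMeasurable C ?_
  filter_upwards [ae_restrict_mem measurableSet_ball] with x hx
  exact hC x (ball_subset_closedBall hx)

/-- The class in `L²(B⁴)` of a continuous function on `ℝ⁴`. -/
noncomputable def toL2Ball : C(E4, ℝ) →ₗ[ℝ] L2Ball where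
  toFun f := (memLp_ball f).toLp f
  map_add' f g := MemLp.toLp_add (memLp_ball f) (memLp_ball g)
  map_smul' c f := MemLp.toLp_const_smul c (memLp_ball f)

/-- The class in `L²(S³)` of the restriction to `S³` of a continuous function on `ℝ⁴`. -/
noncomputable def toL2Sphere : C(E4, ℝ) →ₗ[ℝ] L2Sphere :=
  (ContinuousMap.toLp 2 sphereMeasure ℝ).toLinearMap ∘ₗ
    (ContinuousMap.compRightAlgHom ℝ ℝ (⟨_, continuous_subtype_val⟩ : C(S3, E4))).toLinearMap

variable {f g : C(E4, ℝ)} {u : L2Ball} {t : L2Sphere}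

lemma coeFn_toL2Ball (f : C(E4, ℝ)) : toL2Ball f =ᵐ[ballMeasure] f :=
  (memLp_ball f).coeFn_toLp

lemma coeFn_toL2Sphere (f : C(E4, ℝ)) : toL2Sphere f =ᵐ[sphereMeasure] fun x : S3 => f x :=
  ContinuousMap.coeFn_toLp _ _

lemma eq_toL2Ball_iff : u = toL2Ball f ↔ u =ᵐ[ballMeasure] f := by
  rw [Lp.ext_iff]
  exact ⟨fun h => h.trans (coeFn_toL2Ball f), fun h => h.trans (coeFn_toL2Ball f).symm⟩

lemma toL2Ball_eq_iff : toL2Ball f = toL2Ball g ↔ EqOn f g (ball 0 1) := by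
  rw [eq_toL2Ball_iff]
  refine ⟨fun h => Measure.eqOn_open_of_ae_eq ((coeFn_toL2Ball f).symm.trans h) isOpen_ball
    f.continuous.continuousOn g.continuous.continuousOn, fun h => ?_⟩
  filter_upwards [coeFn_toL2Ball f, ae_restrict_mem measurableSet_ball] with x hx hxb
  rw [hx, h hxb]

lemma toL2Sphere_congr (h : EqOn f g (sphere 0 1)) : toL2Sphere f = toL2Sphere g :=
  congrArg (ContinuousMap.toLp 2 sphereMeasure ℝ) (ContinuousMap.ext fun x => h x.2)

lemma ballInt_eq_inner (u : L2Ball) (f : C(E4, ℝ)) : ballInt u f = inner ℝ (toL2Ball f) u := by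
  rw [L2.inner_def]
  refine integral_congr_ae ?_
  filter_upwards [coeFn_toL2Ball f] with x hx
  rw [hx]
  rfl

lemma sphereInt_eq_inner (t : L2Sphere) (f : C(E4, ℝ)) :
    sphereInt t f = inner ℝ (toL2Sphere f) t := by
  rw [L2.inner_def]
  refine integral_congr_ae ?_
  filter_upwards [coeFn_toL2Sphere f] with x hx
  rw [hx]
  rfl

lemma ballInt_toL2Ball (f : C(E4, ℝ)) (η : E4 → ℝ) :
    ballInt (toL2Ball f) η = ∫ x, f x * η x ∂ballMeasure := by
  refine integral_congr_ae ?_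
  filter_upwards [coeFn_toL2Ball f] with x hx
  rw [hx]

lemma sphereInt_toL2Sphere (f : C(E4, ℝ)) (η : E4 → ℝ) :
    sphereInt (toL2Sphere f) η = ∫ x : S3, f x * η x ∂sphereMeasure := by
  refine integral_congr_ae ?_
  filter_upwards [coeFn_toL2Sphere f] with x hx
  rw [hx]

lemma sphereInt_congr {η θ : E4 → ℝ} (h : EqOn η θ (sphere 0 1)) :
    sphereInt t η = sphereInt t θ :=
  integral_congr_ae (.of_forall fun x => congrArg (t x * ·) (h x.2))

lemma integrable_L2Ball (u : L2Ball) : Integrable u ballMeasure :=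
  (Lp.memLp u).integrable (by norm_num)

lemma eq_zero_of_ballInt_test (h : ∀ η, IsTest η → ballInt u η = 0) : u = 0 := by
  rw [Lp.eq_zero_iff_ae_eq_zero, Filter.EventuallyEq, ae_restrict_iff' measurableSet_ball]
  refine isOpen_ball.ae_eq_zero_of_integral_contDiff_smul_eq_zero
    (IntegrableOn.locallyIntegrableOn (integrable_L2Ball u)) fun η hη hc hs => ?_
  have hvanish (x) (hx : x ∉ ball (0 : E4) 1) : η x • u x = 0 := by
    rw [image_eq_zero_of_notMem_tsupport fun h => hx (hs h), zero_smul]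
  rw [← setIntegral_eq_integral_of_forall_compl_eq_zero hvanish, ← h η ⟨hη, hc, hs⟩]
  simp only [ballInt, smul_eq_mul, mul_comm]

lemma eq_zero_of_ballInt_polyMap (h : ∀ p, ballInt u (polyMap p) = 0) : u = 0 := by
  refine eq_zero_of_ballInt_test fun η hη => ?_
  refine integral_mul_comp_eq_zero_of_polyMap (integrable_L2Ball u) measurable_id
    (isCompact_closedBall 0 1) ?_ h ⟨η, hη.1.continuous⟩
  exact (ae_restrict_mem measurableSet_ball).mono fun x hx => ball_subset_closedBall hx

lemma eq_zero_of_sphereInt_polyMap (h : ∀ p, sphereInt t (polyMap p) = 0) : t = 0 := by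
  have hdense := ContinuousMap.toLp_denseRange ℝ sphereMeasure ℝ (p := 2) (by norm_num)
  refine hdense.eq_zero_of_inner_left ℝ fun f => ?_
  obtain ⟨g, rfl⟩ := ContinuousMap.exists_restrict_eq (isClosed_sphere (x := (0 : E4)) (ε := 1)) f
  rw [real_inner_comm]
  refine (sphereInt_eq_inner t g).symm.trans ?_
  exact integral_mul_comp_eq_zero_of_polyMap ((Lp.memLp t).integrable (by norm_num))
    measurable_subtype_coe (isCompact_sphere 0 1) (.of_forall Subtype.prop) h g

/-- The class in `L²(B⁴)` of a polynomial. -/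
noncomputable def polyBall : MvPolynomial (Fin 4) ℝ →ₗ[ℝ] L2Ball :=
  toL2Ball ∘ₗ polyMap.toLinearMap

/-- The class in `L²(S³)` of a polynomial. -/
noncomputable def polySphere : MvPolynomial (Fin 4) ℝ →ₗ[ℝ] L2Sphere :=
  toL2Sphere ∘ₗ polyMap.toLinearMap

lemma polyBall_injective : Function.Injective polyBall := by
  refine (injective_iff_map_eq_zero _).2 fun p hp => eq_zero_of_eqOn_ball ?_
  exact toL2Ball_eq_iff.1 (hp.trans (map_zero toL2Ball).symm)

lemma eq_zero_of_sphereInt_harmonic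
    (h : ∀ j, ∀ q ∈ harmonicSubmodule (Fin 4) ℝ j, sphereInt t (polyMap q) = 0) : t = 0 := by
  have hfun : (innerₗ L2Sphere).flip t ∘ₗ polySphere = 0 := by
    refine LinearMap.ext_on span_sumSq_pow_mul_harmonic_eq_top ?_
    rintro _ ⟨m, j, q, hq, rfl⟩
    have hpow : polySphere (sumSq (Fin 4) ℝ ^ m * q) = polySphere q :=
      toL2Sphere_congr fun x hx => by
        simp [polyMap_sumSq_apply, mem_sphere_zero_iff_norm.1 hx]
    rw [LinearMap.comp_apply, hpow]
    exact (sphereInt_eq_inner t (polyMap q)).symm.trans (h j q hq)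
  exact eq_zero_of_sphereInt_polyMap fun p =>
    (sphereInt_eq_inner t (polyMap p)).trans (LinearMap.congr_fun hfun p)

end L2Classes

section WeakCalculus

variable {u v w w' : L2Ball} {s t t' n n' : L2Sphere} {g g' : Fin 4 → L2Ball} {i : Fin 4}

lemma ballInt_sub (u v : L2Ball) {f : E4 → ℝ} (hf : Continuous f) :
    ballInt (u - v) f = ballInt u f - ballInt v f := by
  rw [eq_sub_iff_add_eq, ← ballInt_add _ _ hf, sub_add_cancel]

lemma sphereInt_sub (s t : L2Sphere) {f : E4 → ℝ} (hf : ContinuousOn f (sphere 0 1)) :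
    sphereInt (s - t) f = sphereInt s f - sphereInt t f := by
  rw [eq_sub_iff_add_eq, ← sphereInt_add _ _ hf, sub_add_cancel]

lemma ballInt_sum {ι : Type*} (s : Finset ι) (u : L2Ball) {f : ι → E4 → ℝ}
    (hf : ∀ i, Continuous (f i)) :
    ballInt u (fun x => ∑ i ∈ s, f i x) = ∑ i ∈ s, ballInt u (f i) := by
  simp only [ballInt, Finset.mul_sum]
  exact integral_finsetSum _ fun i _ => ball_integrable u (hf i)

lemma sphereInt_sum {ι : Type*} (s : Finset ι) (t : L2Sphere) {f : ι → E4 → ℝ}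
    (hf : ∀ i, Continuous (f i)) :
    sphereInt t (fun x => ∑ i ∈ s, f i x) = ∑ i ∈ s, sphereInt t (f i) := by
  simp only [sphereInt, Finset.mul_sum]
  exact integral_finsetSum _ fun i _ => sphere_integrable t (hf i).continuousOn

lemma eq_of_ballInt_test (h : ∀ η, IsTest η → ballInt u η = ballInt v η) : u = v :=
  sub_eq_zero.1 <| eq_zero_of_ballInt_test fun η hη => by
    rw [ballInt_sub _ _ hη.1.continuous, h η hη, sub_self]

lemma eq_of_sphereInt_contDiff
    (h : ∀ η : E4 → ℝ, ContDiff ℝ ∞ η → sphereInt s η = sphereInt t η) : s = t :=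
  sub_eq_zero.1 <| eq_zero_of_sphereInt_polyMap fun p => by
    rw [sphereInt_sub _ _ (polyMap p).continuous.continuousOn, h _ (contDiff_polyMap p), sub_self]

lemma HasWeakGrad.unique (h : HasWeakGrad u g) (h' : HasWeakGrad u g') : g = g' :=
  funext fun i => eq_of_ballInt_test fun η hη =>
    neg_injective <| (h i η hη).symm.trans (h' i η hη)

lemma HasWeakLap.unique (h : HasWeakLap u w) (h' : HasWeakLap u w') : w = w' :=
  eq_of_ballInt_test fun η hη => (h η hη).symm.trans (h' η hη)

lemma sphereInt_eq_sum_sphereInt_mul_coord (t : L2Sphere) {η : E4 → ℝ} (hη : Continuous η) :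
    sphereInt t η = ∑ i, sphereInt t (fun x => η x * x i * x i) := by
  have hcoord (i : Fin 4) : Continuous fun x : E4 => x i := (contDiff_coord i (n := 0)).continuous
  rw [← sphereInt_sum (f := fun i x => η x * x i * x i) _ _
    fun i => (hη.mul (hcoord i)).mul (hcoord i)]
  refine sphereInt_congr fun x hx => ?_
  simp only [mul_assoc, ← Finset.mul_sum, ← sq]
  rw [← EuclideanSpace.real_norm_sq_eq, mem_sphere_zero_iff_norm.1 hx, one_pow, mul_one]

lemma HasTrace.unique (h : HasTrace u t) (h' : HasTrace u t') : t = t' := by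
  obtain ⟨g, hg, ht⟩ := h
  obtain ⟨g', hg', ht'⟩ := h'
  obtain rfl := hg.unique hg'
  refine eq_of_sphereInt_contDiff fun η hη => ?_
  rw [sphereInt_eq_sum_sphereInt_mul_coord t hη.continuous,
    sphereInt_eq_sum_sphereInt_mul_coord t' hη.continuous]
  refine Finset.sum_congr rfl fun i _ => ?_
  have hηi : ContDiff ℝ ∞ fun x : E4 => η x * x i := hη.mul (contDiff_coord i)
  exact (ht i _ hηi).symm.trans (ht' i _ hηi)

lemma HasNormalDeriv.unique (h : HasNormalDeriv u n) (h' : HasNormalDeriv u n') : n = n' := by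
  obtain ⟨g, w, hg, hw, hn⟩ := h
  obtain ⟨g', w', hg', hw', hn'⟩ := h'
  obtain rfl := hg.unique hg'
  obtain rfl := hw.unique hw'
  exact eq_of_sphereInt_contDiff fun η hη => (hn η hη).symm.trans (hn' η hη)

lemma lap_eq_sum_partialD {η : E4 → ℝ} (hη : ContDiff ℝ ∞ η) :
    lap η = fun x => ∑ i, partialD i (partialD i η) x :=
  funext fun x => lap_eq_sum (contDiffAt_two_of_contDiff hη x)

lemma HasTrace.sum_ballInt_partialD (ht : HasTrace u t) (hg : HasWeakGrad u g) {η : E4 → ℝ}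
    (hη : ContDiff ℝ ∞ η) :
    ballInt u (lap η) + ∑ i, ballInt (g i) (partialD i η) = sphereInt t (normalD η) := by
  obtain ⟨g', hg', ht⟩ := ht
  obtain rfl := hg.unique hg'
  have hη' (i) := contDiff_partialD i hη
  have hcoord (i : Fin 4) : Continuous fun x : E4 => x i := (contDiff_coord i (n := 0)).continuous
  have hnormal : normalD η = fun x => ∑ i, partialD i η x * x i :=
    funext fun x => by simp only [normalD_eq_sum, mul_comm]
  rw [lap_eq_sum_partialD hη, ballInt_sum _ _ fun i => continuous_partialD i (hη' i), hnormal,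
    sphereInt_sum (f := fun i x => partialD i η x * x i) _ _
      fun i => (hη' i).continuous.mul (hcoord i), ← Finset.sum_add_distrib]
  exact Finset.sum_congr rfl fun i _ => ht i _ (hη' i)

lemma HasTrace.green (ht : HasTrace u t) (hn : HasNormalDeriv u n) (hw : HasWeakLap u w)
    {η : E4 → ℝ} (hη : ContDiff ℝ ∞ η) :
    ballInt u (lap η) - ballInt w η = sphereInt t (normalD η) - sphereInt n η := by
  obtain ⟨g, w', hg, hw', hn⟩ := hn
  obtain rfl := hw.unique hw'
  rw [← ht.sum_ballInt_partialD hg hη, ← hn η hη]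
  ring

end WeakCalculus

section SmoothFunctions

variable {f w n : C(E4, ℝ)} {η : E4 → ℝ}

lemma ballInt_toL2Ball_partialD_add (hf : ContDiff ℝ ∞ f) (hη : ContDiff ℝ ∞ η) (i : Fin 4) :
    ballInt (toL2Ball f) (partialD i η)
      + ballInt (toL2Ball ⟨partialD i f, continuous_partialD i hf⟩) η
      = sphereInt (toL2Sphere f) (fun x => η x * x i) := by
  have hparts := integral_ball_partialD (hf.mul hη) i
  simp only [partialD_mul (differentiableAt_of_contDiff hf _) (differentiableAt_of_contDiff hη _),
    mul_assoc] at hparts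
  rw [ballInt_toL2Ball, ballInt_toL2Ball, sphereInt_toL2Sphere, ← hparts]
  exact (integral_add (integrableOn_ball_of_continuous
      (hf.continuous.mul (continuous_partialD i hη)))
    (integrableOn_ball_of_continuous ((continuous_partialD i hf).mul hη.continuous))).symm

lemma IsTest.notMem_tsupport (hη : IsTest η) {x : E4} (hx : x ∈ sphere 0 1) : x ∉ tsupport η :=
  fun h => sphere_disjoint_ball.le_bot ⟨hx, hη.2.2 h⟩

lemma IsTest.eqOn_zero (hη : IsTest η) : EqOn η 0 (sphere 0 1) :=
  fun _ hx => image_eq_zero_of_notMem_tsupport (hη.notMem_tsupport hx)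

lemma IsTest.normalD_eqOn_zero (hη : IsTest η) : EqOn (normalD η) 0 (sphere 0 1) := fun x hx => by
  rw [normalD, fderiv_of_notMem_tsupport ℝ (hη.notMem_tsupport hx)]
  rfl

lemma sphereInt_eq_zero (t : L2Sphere) (h : EqOn η 0 (sphere 0 1)) : sphereInt t η = 0 := by
  rw [sphereInt_congr h]
  simp [sphereInt]

lemma hasWeakGrad_toL2Ball (hf : ContDiff ℝ ∞ f) :
    HasWeakGrad (toL2Ball f) fun i => toL2Ball ⟨partialD i f, continuous_partialD i hf⟩ := by
  intro i η hη
  rw [eq_neg_iff_add_eq_zero, ballInt_toL2Ball_partialD_add hf hη.1]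
  exact sphereInt_eq_zero _ fun x hx => by rw [hη.eqOn_zero hx, Pi.zero_apply, zero_mul]

lemma memH2_toL2Ball (hf : ContDiff ℝ ∞ f) : MemH2 (toL2Ball f) :=
  ⟨_, hasWeakGrad_toL2Ball hf, fun i =>
    ⟨_, hasWeakGrad_toL2Ball (f := ⟨partialD i f, continuous_partialD i hf⟩)
      (contDiff_partialD i hf)⟩⟩

lemma hasTrace_toL2Ball (hf : ContDiff ℝ ∞ f) : HasTrace (toL2Ball f) (toL2Sphere f) :=
  ⟨_, hasWeakGrad_toL2Ball hf, fun i _ hη => ballInt_toL2Ball_partialD_add hf hη i⟩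

lemma sum_ballInt_partialD_toL2Ball (hf : ContDiff ℝ ∞ f) (hw : EqOn (lap f) w (ball 0 1))
    (hn : EqOn (normalD f) n (sphere 0 1)) (hη : ContDiff ℝ ∞ η) :
    (∑ i, ballInt (toL2Ball ⟨partialD i f, continuous_partialD i hf⟩) (partialD i η))
      + ballInt (toL2Ball w) η = sphereInt (toL2Sphere n) η := by
  have hf' (i) : ContDiff ℝ ∞ (partialD i f) := contDiff_partialD i hf
  have hlap : ballInt (toL2Ball w) η =
      ∑ i, ballInt (toL2Ball ⟨partialD i (partialD i f), continuous_partialD i (hf' i)⟩) η := by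
    simp only [ballInt_toL2Ball, ContinuousMap.coe_mk]
    rw [← integral_finsetSum (f := fun i x => partialD i (partialD i f) x * η x) _ fun i _ =>
      integrableOn_ball_of_continuous ((continuous_partialD i (hf' i)).mul hη.continuous)]
    refine setIntegral_congr_fun measurableSet_ball fun x hx => ?_
    rw [← hw hx, lap_eq_sum_partialD hf, Finset.sum_mul]
  have hnormal : sphereInt (toL2Sphere n) η = ∑ i, sphereInt
      (toL2Sphere ⟨partialD i f, (hf' i).continuous⟩) (fun x => η x * x i) := by
    simp only [sphereInt_toL2Sphere, ContinuousMap.coe_mk]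
    rw [← integral_finsetSum _ fun i _ => integrable_sphere (f := fun x => partialD i f x *
      (η x * x i)) ((hf' i).mul (hη.mul (contDiff_coord i))).continuous]
    refine integral_congr_ae (.of_forall fun x => ?_)
    simp only [← hn x.2, normalD_eq_sum, Finset.sum_mul]
    exact Finset.sum_congr rfl fun i _ => by ring
  rw [hlap, hnormal, ← Finset.sum_add_distrib]
  exact Finset.sum_congr rfl fun i _ =>
    ballInt_toL2Ball_partialD_add (f := ⟨partialD i f, (hf' i).continuous⟩) (hf' i) hη i

lemma hasWeakLap_toL2Ball (hf : ContDiff ℝ ∞ f) (hw : EqOn (lap f) w (ball 0 1)) :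
    HasWeakLap (toL2Ball f) (toL2Ball w) := fun η hη => by
  have htrace := (hasTrace_toL2Ball hf).sum_ballInt_partialD (hasWeakGrad_toL2Ball hf) hη.1
  have hnormal := sum_ballInt_partialD_toL2Ball (n := ⟨_, (contDiff_normalD hf).continuous⟩)
    hf hw (fun _ _ => rfl) hη.1
  rw [sphereInt_eq_zero _ hη.normalD_eqOn_zero] at htrace
  rw [sphereInt_eq_zero _ hη.eqOn_zero] at hnormal
  linarith

lemma hasNormalDeriv_toL2Ball (hf : ContDiff ℝ ∞ f) (hn : EqOn (normalD f) n (sphere 0 1)) :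
    HasNormalDeriv (toL2Ball f) (toL2Sphere n) := by
  have hw : EqOn (lap f) (⟨lap f, continuous_lap hf⟩ : C(E4, ℝ)) (ball 0 1) := fun _ _ => rfl
  exact ⟨_, _, hasWeakGrad_toL2Ball hf, hasWeakLap_toL2Ball hf hw,
    fun _ => sum_ballInt_partialD_toL2Ball hf hw hn⟩

lemma sphereLap_eqOn_zero (h : EqOn η 0 (sphere 0 1)) : EqOn (sphereLap η) 0 (sphere 0 1) :=
  fun x hx => by
    rw [sphereLap_congr h (ne_zero_of_mem_sphere hx)]
    simp [sphereLap, lap]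

end SmoothFunctions

section ClassicalSolutions

variable {Λ : ℝ} {f : E4 → ℝ}

lemma IsClassicalSolution.sphereLap_eqOn (h : IsClassicalSolution Λ f) :
    EqOn (sphereLap f) (fun x => -(1 / 2) * normalD (lap f) x - Λ * f x) (sphere 0 1) := by
  obtain ⟨-, -, hP, hn⟩ := h
  intro x hx
  have hPx := hP x hx
  rw [P3b, sphereLap_eqOn_zero hn hx, Pi.zero_apply] at hPx
  dsimp only
  linarith

lemma IsClassicalSolution.isSolution (h : IsClassicalSolution Λ f) :
    IsSolution Λ (toL2Ball ⟨f, h.1.continuous⟩) := by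
  have hsph := h.sphereLap_eqOn
  obtain ⟨hf, hbi, -, hn⟩ := h
  have hlf := contDiff_lap hf
  set F : C(E4, ℝ) := ⟨f, hf.continuous⟩
  set W : C(E4, ℝ) := ⟨lap f, hlf.continuous⟩
  set N : C(E4, ℝ) := ⟨normalD (lap f), (contDiff_normalD hlf).continuous⟩
  have hF : ContDiff ℝ ∞ F := hf
  have hW : ContDiff ℝ ∞ W := hlf
  have hlapF : HasWeakLap (toL2Ball F) (toL2Ball W) := hasWeakLap_toL2Ball hF fun _ _ => rfl
  have hlapW : HasWeakLap (toL2Ball W) 0 := by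
    simpa only [map_zero] using hasWeakLap_toL2Ball (w := 0) hW hbi
  have hnF : HasNormalDeriv (toL2Ball F) 0 := by
    simpa only [map_zero] using hasNormalDeriv_toL2Ball (n := 0) hF hn
  have hnW : HasNormalDeriv (toL2Ball W) (toL2Sphere N) := hasNormalDeriv_toL2Ball hW fun _ _ => rfl
  refine ⟨memH2_toL2Ball hF, ⟨_, hlapF, hlapW⟩, ⟨_, hasTrace_toL2Ball hF, _, _, _, _, hlapF, hlapW,
    hasTrace_toL2Ball hF, hnF, fun ψ hψ hψn => ?_⟩, hnF⟩
  have hgreen := (hasTrace_toL2Ball hW).green hnW hlapW hψ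
  rw [sphereInt_eq_zero _ hψn, ballInt_zero] at hgreen
  have hsymm : sphereInt (toL2Sphere F) (sphereLap ψ) =
      sphereInt (toL2Sphere (-(1 / 2 : ℝ) • N - Λ • F)) ψ := by
    rw [sphereInt_toL2Sphere, sphereInt_toL2Sphere]
    refine (integral_sphere_sphereLap_comm hf hψ).trans ?_
    exact integral_congr_ae (.of_forall fun x => congrArg (· * ψ x) (hsph x.2))
  rw [map_sub, map_smul, map_smul, sphereInt_sub _ _ hψ.continuous.continuousOn, sphereInt_smul,
    sphereInt_smul] at hsymm
  rw [ballInt_zero, sphereInt_zero, sphereInt_smul, hsymm]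
  linarith

end ClassicalSolutions

/-! ### Uniqueness for weakly harmonic and biharmonic functions -/

section Uniqueness

variable {u w : L2Ball} {r : E4 → ℝ}

lemma isTest_cutoff_mul (n : ℕ) (hr : ContDiff ℝ ∞ r) :
    IsTest fun x => cutoff n (1 - ‖x‖ ^ 2) * r x := by
  have hsupp : tsupport (fun x : E4 => cutoff n (1 - ‖x‖ ^ 2) * r x) ⊆ ball 0 1 :=
    (tsupport_mul_subset_left (f := fun x : E4 => cutoff n (1 - ‖x‖ ^ 2))).trans
      tsupport_cutoff_one_sub_norm_sq_subset
  exact ⟨(contDiff_comp_one_sub_norm_sq contDiff_cutoff).mul hr,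
    HasCompactSupport.of_support_subset_isCompact (isCompact_closedBall 0 1)
      ((subset_tsupport _).trans (hsupp.trans ball_subset_closedBall)), hsupp⟩

lemma tendsto_ballInt_mul_iteratedDeriv_cutoff (w : L2Ball) {f : E4 → ℝ} (hf : Continuous f)
    (k : ℕ) :
    Filter.Tendsto (fun n => ballInt w fun x =>
      f x * ((1 - ‖x‖ ^ 2) ^ k * iteratedDeriv k (cutoff n) (1 - ‖x‖ ^ 2))) Filter.atTop
      (nhds (if k = 0 then ballInt w f else 0)) := by
  simpa only [ballInt, mul_assoc] using
    tendsto_setIntegral_mul_iteratedDeriv_cutoff (ball_integrable w hf) k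

lemma ballInt_fun_add (u : L2Ball) {f g : E4 → ℝ} (hf : Continuous f) (hg : Continuous g) :
    ballInt u (fun x => f x + g x) = ballInt u f + ballInt u g := by
  simp only [ballInt, mul_add]
  exact integral_add (ball_integrable u hf) (ball_integrable u hg)

-- The factor `(1 - ‖x‖ ^ 2) ^ 2` absorbs the derivatives of order at most two of the cutoffs.
lemma lap_cutoff_mul (n : ℕ) (hr : ContDiff ℝ ∞ r) (x : E4) :
    lap (fun y => cutoff n (1 - ‖y‖ ^ 2) * ((1 - ‖y‖ ^ 2) ^ 2 * r y)) x =
      lap (fun y => (1 - ‖y‖ ^ 2) ^ 2 * r y) x *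
          ((1 - ‖x‖ ^ 2) ^ 0 * iteratedDeriv 0 (cutoff n) (1 - ‖x‖ ^ 2))
        + (16 * ‖x‖ ^ 2 * r x - 4 * (1 - ‖x‖ ^ 2) * (normalD r x + 2 * r x)) *
          ((1 - ‖x‖ ^ 2) ^ 1 * iteratedDeriv 1 (cutoff n) (1 - ‖x‖ ^ 2))
        + 4 * ‖x‖ ^ 2 * r x *
          ((1 - ‖x‖ ^ 2) ^ 2 * iteratedDeriv 2 (cutoff n) (1 - ‖x‖ ^ 2)) := by
  have hsq : HasDerivAt (fun s : ℝ => s ^ 2) (2 * (1 - ‖x‖ ^ 2)) (1 - ‖x‖ ^ 2) := by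
    simpa using hasDerivAt_pow 2 (1 - ‖x‖ ^ 2)
  have hnormal : normalD (fun y => (1 - ‖y‖ ^ 2) ^ 2 * r y) x =
      (1 - ‖x‖ ^ 2) ^ 2 * normalD r x - 2 * (2 * (1 - ‖x‖ ^ 2)) * ‖x‖ ^ 2 * r x := by
    rw [normalD, fderiv_comp_one_sub_norm_sq_mul_apply hsq (differentiableAt_of_contDiff hr x),
      real_inner_self_eq_norm_sq, normalD]
  have hF : ContDiff ℝ ∞ fun y : E4 => (1 - ‖y‖ ^ 2) ^ 2 * r y :=
    (contDiff_comp_one_sub_norm_sq (contDiff_id.pow 2)).mul hr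
  rw [lap_comp_one_sub_norm_sq_mul contDiff_cutoff hF, hnormal, iteratedDeriv_zero,
    iteratedDeriv_one, iteratedDeriv_succ, iteratedDeriv_one]
  ring

lemma HasWeakLap.ballInt_lap_eq_zero (hw : HasWeakLap w 0) (hr : ContDiff ℝ ∞ r) :
    ballInt w (lap fun x => (1 - ‖x‖ ^ 2) ^ 2 * r x) = 0 := by
  have hF : ContDiff ℝ ∞ fun x : E4 => (1 - ‖x‖ ^ 2) ^ 2 * r x :=
    (contDiff_comp_one_sub_norm_sq (contDiff_id.pow 2)).mul hr
  have hf₀ := continuous_lap hF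
  have hr' := hr.continuous
  have hN := (contDiff_normalD hr).continuous
  have hf₁ : Continuous fun x =>
      16 * ‖x‖ ^ 2 * r x - 4 * (1 - ‖x‖ ^ 2) * (normalD r x + 2 * r x) := by fun_prop
  have hf₂ : Continuous fun x => 4 * ‖x‖ ^ 2 * r x := by fun_prop
  have hlim := ((tendsto_ballInt_mul_iteratedDeriv_cutoff w hf₀ 0).add
    (tendsto_ballInt_mul_iteratedDeriv_cutoff w hf₁ 1)).add
    (tendsto_ballInt_mul_iteratedDeriv_cutoff w hf₂ 2)
  simp only [if_true, one_ne_zero, two_ne_zero, if_false, add_zero] at hlim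
  refine tendsto_nhds_unique hlim (tendsto_const_nhds.congr fun n => ?_)
  have hcut (k : ℕ) :
      Continuous fun x : E4 => (1 - ‖x‖ ^ 2) ^ k * iteratedDeriv k (cutoff n) (1 - ‖x‖ ^ 2) :=
    (by fun_prop : Continuous fun x : E4 => (1 - ‖x‖ ^ 2) ^ k).mul
      ((contDiff_cutoff.continuous_iteratedDeriv k (by exact_mod_cast le_top)).comp (by fun_prop))
  calc (0 : ℝ) = ballInt w (lap fun x => cutoff n (1 - ‖x‖ ^ 2) * ((1 - ‖x‖ ^ 2) ^ 2 * r x)) := by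
        rw [hw _ (isTest_cutoff_mul n hF), ballInt_zero]
    _ = _ := by
        rw [funext (lap_cutoff_mul n hr), ballInt_fun_add, ballInt_fun_add]
        exacts [hf₀.mul (hcut 0), hf₁.mul (hcut 1), (hf₀.mul (hcut 0)).add (hf₁.mul (hcut 1)),
          hf₂.mul (hcut 2)]

lemma HasWeakLap.eq_zero_of_harmonic (hw : HasWeakLap w 0)
    (h : ∀ j, ∀ q ∈ harmonicSubmodule (Fin 4) ℝ j, ballInt w (polyMap q) = 0) : w = 0 := by
  have hinner (p) : ballInt w (polyMap p) = ((innerₗ L2Ball).flip w ∘ₗ polyBall) p :=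
    ballInt_eq_inner w (polyMap p)
  have hfun : (innerₗ L2Ball).flip w ∘ₗ polyBall = 0 := by
    refine eq_zero_of_polyLap_one_sub_sumSq_sq_mul _ (fun p => ?_) fun j q hq => ?_
    · rw [← hinner, ← lap_polyMap, ← hw.ballInt_lap_eq_zero (contDiff_polyMap p)]
      congr 2
      funext x
      simp [polyMap_sumSq_apply]
    · rw [← hinner, h j q hq]
  exact eq_zero_of_ballInt_polyMap fun p => (hinner p).trans (LinearMap.congr_fun hfun p)

lemma IsBiharmonic.eq_zero (hu : IsBiharmonic u) (ht : HasTrace u 0) (hn : HasNormalDeriv u 0) :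
    u = 0 := by
  obtain ⟨w, hw, hw0⟩ := hu
  have hgreen {η : E4 → ℝ} (hη : ContDiff ℝ ∞ η) : ballInt u (lap η) = ballInt w η := by
    simpa only [sphereInt_zero, sub_zero, sub_eq_zero] using ht.green hn hw hη
  have hw_zero : w = 0 := hw0.eq_zero_of_harmonic fun j q hq => by
    rw [← hgreen (contDiff_polyMap q), lap_polyMap_eq_zero hq]
    simp [ballInt]
  refine eq_zero_of_ballInt_polyMap fun p => ?_
  obtain ⟨q, rfl⟩ := polyLap_surjective p
  rw [← lap_polyMap, hgreen (contDiff_polyMap q), hw_zero, ballInt_zero]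

end Uniqueness

section BiharmonicExtension

/-- The extension `p ↦ ½ (k + 2 - k |x|²) p` of boundary values into the ball, with the factor
written as `1 + (k / 2) (1 - |x|²)`. It has vanishing normal derivative on the sphere when `p` is
homogeneous of degree `k`. -/
noncomputable def biharmonicExt (k : ℕ) : MvPolynomial (Fin 4) ℝ →ₗ[ℝ] MvPolynomial (Fin 4) ℝ :=
  LinearMap.mulLeft ℝ (1 + (k / 2 : ℝ) • (1 - sumSq (Fin 4) ℝ))

variable {p : MvPolynomial (Fin 4) ℝ} {k : ℕ}

lemma polyMap_biharmonicExt_apply (k : ℕ) (p : MvPolynomial (Fin 4) ℝ) (x : E4) :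
    polyMap (biharmonicExt k p) x = (1 + k / 2 * (1 - ‖x‖ ^ 2)) * polyMap p x := by
  simp [biharmonicExt, polyMap_sumSq_apply]

lemma biharmonicExt_injective (k : ℕ) : Function.Injective (biharmonicExt k) := by
  refine mul_right_injective₀ fun h => ?_
  have hzero : (1 + k / 2 : ℝ) = 0 := by
    simpa [polyMap_sumSq_apply] using congrArg (fun r => polyMap r 0) h
  exact absurd hzero (by positivity)

lemma polyMap_biharmonicExt_eqOn_sphere (k : ℕ) (p : MvPolynomial (Fin 4) ℝ) :
    EqOn (polyMap (biharmonicExt k p)) (polyMap p) (sphere 0 1) := fun x hx => by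
  simp [polyMap_biharmonicExt_apply, mem_sphere_zero_iff_norm.1 hx]

lemma polyLap_biharmonicExt (hp : p ∈ harmonicSubmodule (Fin 4) ℝ k) :
    polyLap (Fin 4) ℝ (biharmonicExt k p) = (-(2 * k * (k + 2)) : ℝ) • p := by
  have hp0 : polyLap (Fin 4) ℝ p = 0 := hp.2
  rw [biharmonicExt, LinearMap.mulLeft_apply, add_mul, smul_mul_assoc, sub_mul, one_mul, map_add,
    map_smul, map_sub, polyLap_sumSq_mul hp.1, hp0, mul_zero, add_zero, zero_sub, zero_add,
    smul_neg, smul_smul, ← neg_smul, Fintype.card_fin]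
  congr 1
  push_cast
  ring

lemma normalD_biharmonicExt (hp : p.IsHomogeneous k) :
    EqOn (normalD (polyMap (biharmonicExt k p))) 0 (sphere 0 1) := fun x hx => by
  have hfactor : HasDerivAt (fun s : ℝ => 1 + k / 2 * s) (k / 2) (1 - ‖x‖ ^ 2) := by
    simpa using ((hasDerivAt_id (1 - ‖x‖ ^ 2)).const_mul (k / 2 : ℝ)).const_add 1
  have hnormal : fderiv ℝ (polyMap p) x x = k * polyMap p x := congrFun (normalD_polyMap hp) x
  rw [funext (polyMap_biharmonicExt_apply k p), normalD,
    fderiv_comp_one_sub_norm_sq_mul_apply hfactor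
      (differentiableAt_of_contDiff (contDiff_polyMap p) x),
    hnormal, real_inner_self_eq_norm_sq, mem_sphere_zero_iff_norm.1 hx, Pi.zero_apply]
  ring

lemma sphereLap_polyMap (hp : p ∈ harmonicSubmodule (Fin 4) ℝ k) :
    EqOn (sphereLap (polyMap p)) (fun x => -(k * (k + 2)) * polyMap p x) (sphere 0 1) :=
  fun x hx => by
    have hnormal₂ : normalD (normalD (polyMap p)) x = k * (k * polyMap p x) := by
      have hscaled := congrFun (normalD_polyMap (Submodule.smul_mem
        (MvPolynomial.homogeneousSubmodule (Fin 4) ℝ k) (k : ℝ) hp.1)) x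
      rw [map_smul, ContinuousMap.coe_smul, ← normalD_polyMap hp.1] at hscaled
      rw [hscaled, normalD_polyMap hp.1]
      rfl
    rw [sphereLap_eq (contDiff_polyMap p) hx, lap_polyMap_eq_zero hp, hnormal₂,
      normalD_polyMap hp.1]
    simp only [Pi.zero_apply, Pi.smul_apply, smul_eq_mul]
    ring

lemma sphereLap_biharmonicExt (hp : p ∈ harmonicSubmodule (Fin 4) ℝ k) :
    EqOn (sphereLap (polyMap (biharmonicExt k p))) (fun x => -(k * (k + 2)) * polyMap p x)
      (sphere 0 1) := fun _ hx =>
  (sphereLap_congr (polyMap_biharmonicExt_eqOn_sphere k p) (ne_zero_of_mem_sphere hx)).trans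
    (sphereLap_polyMap hp hx)

lemma isClassicalSolution_biharmonicExt (hp : p ∈ harmonicSubmodule (Fin 4) ℝ k) :
    IsClassicalSolution (k * (k + 1) * (k + 2)) (polyMap (biharmonicExt k p)) := by
  refine ⟨contDiff_polyMap _, fun x _ => ?_, fun x hx => ?_, normalD_biharmonicExt hp.1⟩
  · rw [lap_polyMap, polyLap_biharmonicExt hp, lap_polyMap_eq_zero
      (Submodule.smul_mem _ _ hp), Pi.zero_apply]
  · have hnormal : normalD (lap (polyMap (biharmonicExt k p))) x =
        k * (-(2 * k * (k + 2)) * polyMap p x) := by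
      rw [lap_polyMap, polyLap_biharmonicExt hp,
        normalD_polyMap (Submodule.smul_mem (harmonicSubmodule (Fin 4) ℝ k) _ hp).1]
      simp
    rw [P3b, hnormal, sphereLap_eqOn_zero (normalD_biharmonicExt hp.1) hx, Pi.zero_apply,
      sphereLap_biharmonicExt hp hx, polyMap_biharmonicExt_eqOn_sphere k p hx]
    ring

end BiharmonicExtension

/-! ### The two eigenvalue problems -/

section Eigenspaces

variable {φ ψ u v : L2Ball} {t n : L2Sphere} {p q : MvPolynomial (Fin 4) ℝ} {j k : ℕ} {Λ μ : ℝ}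

lemma HasTrace.sub {s : L2Sphere} (hu : HasTrace u t) (hv : HasTrace v s) :
    HasTrace (u - v) (t - s) := by
  simpa [sub_eq_add_neg] using hu.add (hv.smul (-1))

lemma HasNormalDeriv.sub {m : L2Sphere} (hu : HasNormalDeriv u n) (hv : HasNormalDeriv v m) :
    HasNormalDeriv (u - v) (n - m) := by
  simpa [sub_eq_add_neg] using hu.add (hv.smul (-1))

lemma IsBiharmonic.sub (hu : IsBiharmonic u) (hv : IsBiharmonic v) : IsBiharmonic (u - v) := by
  simpa [sub_eq_add_neg] using hu.add (hv.smul (-1))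

lemma IsBiharmonic.eq_of_cauchyData (hu : IsBiharmonic u) (hv : IsBiharmonic v)
    (hut : HasTrace u t) (hvt : HasTrace v t) (hun : HasNormalDeriv u n)
    (hvn : HasNormalDeriv v n) : u = v := by
  refine sub_eq_zero.1 ((hu.sub hv).eq_zero ?_ ?_)
  · simpa only [sub_self] using hut.sub hvt
  · simpa only [sub_self] using hun.sub hvn

lemma HasWeakLap.isBiharmonic (hu : HasWeakLap u 0) : IsBiharmonic u :=
  ⟨0, hu, fun η _ => by rw [ballInt_zero, ballInt_zero]⟩

lemma ballInt_const_mul (u : L2Ball) (c : ℝ) (f : E4 → ℝ) :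
    ballInt u (fun x => c * f x) = c * ballInt u f := by
  simp only [ballInt, mul_left_comm _ c, integral_const_mul]

lemma sphereInt_const_mul (t : L2Sphere) (c : ℝ) (f : E4 → ℝ) :
    sphereInt t (fun x => c * f x) = c * sphereInt t f := by
  simp only [sphereInt, mul_left_comm _ c, integral_const_mul]

lemma HasTrace.sphereInt_normalD_harmonic (ht : HasTrace u t) (hn : HasNormalDeriv u n)
    (hv : HasWeakLap u v) (hq : q ∈ harmonicSubmodule (Fin 4) ℝ j) :
    sphereInt n (polyMap q) = j * sphereInt t (polyMap q) + ballInt v (polyMap q) := by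
  have hgreen := ht.green hn hv (contDiff_polyMap q)
  have hscale : sphereInt t (normalD (polyMap q)) = j * sphereInt t (polyMap q) := by
    rw [normalD_polyMap hq.1]
    exact sphereInt_const_mul t j _
  have hlap : ballInt u (lap (polyMap q)) = 0 := by
    simp [lap_polyMap_eq_zero hq, ballInt]
  linarith

lemma HasTrace.sphereInt_eq_zero_of_steklov (ht : HasTrace ψ t) (hn : HasNormalDeriv ψ (μ • t))
    (hψ : HasWeakLap ψ 0) (hj : (j : ℝ) ≠ μ) (hq : q ∈ harmonicSubmodule (Fin 4) ℝ j) :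
    sphereInt t (polyMap q) = 0 := by
  have hgreen := ht.sphereInt_normalD_harmonic hn hψ hq
  rw [sphereInt_smul, ballInt_zero, add_zero, eq_comm, ← sub_eq_zero, ← sub_mul] at hgreen
  exact (mul_eq_zero.1 hgreen).resolve_left (sub_ne_zero.2 hj)

lemma hasTrace_polyBall (p : MvPolynomial (Fin 4) ℝ) : HasTrace (polyBall p) (polySphere p) :=
  hasTrace_toL2Ball (contDiff_polyMap p)

lemma hasWeakLap_polyBall (hp : p ∈ harmonicSubmodule (Fin 4) ℝ k) :
    HasWeakLap (polyBall p) 0 := by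
  have hlap : EqOn (lap (polyMap p)) (0 : C(E4, ℝ)) (ball 0 1) := fun x _ =>
    congrFun (lap_polyMap_eq_zero hp) x
  have hweak := hasWeakLap_toL2Ball (contDiff_polyMap p) hlap
  rwa [map_zero] at hweak

lemma hasNormalDeriv_polyBall (hp : p.IsHomogeneous k) :
    HasNormalDeriv (polyBall p) ((k : ℝ) • polySphere p) := by
  have hnormal : EqOn (normalD (polyMap p)) ((k : ℝ) • polyMap p : C(E4, ℝ)) (sphere 0 1) :=
    fun x _ => congrFun (normalD_polyMap hp) x
  have hscaled := hasNormalDeriv_toL2Ball (contDiff_polyMap p) hnormal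
  rwa [map_smul] at hscaled

lemma isSteklovSolution_polyBall (hp : p ∈ harmonicSubmodule (Fin 4) ℝ k) :
    IsSteklovSolution k (polyBall p) :=
  ⟨hasWeakLap_polyBall hp, _, hasTrace_polyBall p, hasNormalDeriv_polyBall hp.1⟩

lemma mem_map_polySphere_of_orthogonal
    (h : ∀ j ≠ k, ∀ q ∈ harmonicSubmodule (Fin 4) ℝ j, sphereInt t (polyMap q) = 0) :
    t ∈ (harmonicSubmodule (Fin 4) ℝ k).map polySphere := by
  obtain ⟨_, ⟨p, hp, rfl⟩, z, hz, rfl⟩ :=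
    ((harmonicSubmodule (Fin 4) ℝ k).map polySphere).exists_add_mem_mem_orthogonal t
  suffices hz0 : z = 0 by
    rw [hz0, add_zero]
    exact ⟨p, hp, rfl⟩
  refine eq_zero_of_sphereInt_harmonic fun j q hq => ?_
  obtain rfl | hj := eq_or_ne j k
  · exact (sphereInt_eq_inner z (polyMap q)).trans (hz _ ⟨q, hq, rfl⟩)
  · have hpq : sphereInt (polySphere p) (polyMap q) = 0 :=
      (hasTrace_polyBall p).sphereInt_eq_zero_of_steklov (hasNormalDeriv_polyBall hp.1)
        (hasWeakLap_polyBall hp) (Nat.cast_injective.ne hj) hq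
    have hsum := h j hj q hq
    rwa [sphereInt_add _ _ (polyMap q).continuous.continuousOn, hpq, zero_add] at hsum

lemma isSteklovSolution_iff_mem_map :
    IsSteklovSolution k ψ ↔ ψ ∈ (harmonicSubmodule (Fin 4) ℝ k).map polyBall := by
  refine ⟨fun ⟨hψ, t, ht, hn⟩ => ?_, ?_⟩
  · obtain ⟨p, hp, rfl⟩ := mem_map_polySphere_of_orthogonal (k := k) (t := t) fun j hj q hq =>
      ht.sphereInt_eq_zero_of_steklov hn hψ (Nat.cast_injective.ne hj) hq
    exact ⟨p, hp, (hasWeakLap_polyBall hp).isBiharmonic.eq_of_cauchyData hψ.isBiharmonic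
      (hasTrace_polyBall p) ht (hasNormalDeriv_polyBall hp.1) hn⟩
  · rintro ⟨p, hp, rfl⟩
    exact isSteklovSolution_polyBall hp

lemma isSolution_biharmonicExt (hp : p ∈ harmonicSubmodule (Fin 4) ℝ k) :
    IsSolution (k * (k + 1) * (k + 2)) (polyBall (biharmonicExt k p)) :=
  (isClassicalSolution_biharmonicExt hp).isSolution

lemma hasTrace_biharmonicExt (k : ℕ) (p : MvPolynomial (Fin 4) ℝ) :
    HasTrace (polyBall (biharmonicExt k p)) (polySphere p) := by
  have htrace := hasTrace_polyBall (biharmonicExt k p)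
  rwa [show polySphere (biharmonicExt k p) = polySphere p from
    toL2Sphere_congr (polyMap_biharmonicExt_eqOn_sphere k p)] at htrace

lemma isNeumannBiharmonicExtension_polyBall_iff (hp : p ∈ harmonicSubmodule (Fin 4) ℝ k) :
    IsNeumannBiharmonicExtension φ (polyBall p) ↔ φ = polyBall (biharmonicExt k p) := by
  obtain ⟨hH2, hbi, -, hn⟩ := isSolution_biharmonicExt hp
  constructor
  · rintro ⟨-, hφ, hφn, t, ht, hφt⟩
    obtain rfl := ht.unique (hasTrace_polyBall p)
    exact hφ.eq_of_cauchyData hbi hφt (hasTrace_biharmonicExt k p) hφn hn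
  · rintro rfl
    exact ⟨hH2, hbi, hn, _, hasTrace_polyBall p, hasTrace_biharmonicExt k p⟩

lemma IsSolution.sphereInt_eq_zero (h : IsSolution Λ φ) (ht : HasTrace φ t)
    (hj : (j * (j + 1) * (j + 2) : ℝ) ≠ Λ) (hq : q ∈ harmonicSubmodule (Fin 4) ℝ j) :
    sphereInt t (polyMap q) = 0 := by
  obtain ⟨-, ⟨w, hw, hw0⟩, ⟨t', ht', w', z, t'', n, hw', hz, ht'', hn', hP⟩, hn⟩ := h
  obtain rfl := hw.unique hw'
  obtain rfl := hw0.unique hz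
  obtain rfl := ht.unique ht'
  obtain rfl := ht.unique ht''
  obtain rfl := hn.unique hn'
  have hgreen := ht.sphereInt_normalD_harmonic hn hw hq
  have hweak := hP _ (contDiff_polyMap (biharmonicExt j q)) (normalD_biharmonicExt hq.1)
  have hlap : ballInt w (lap (polyMap (biharmonicExt j q))) =
      -(2 * j * (j + 2)) * ballInt w (polyMap q) := by
    rw [lap_polyMap, polyLap_biharmonicExt hq, map_smul]
    exact ballInt_const_mul w _ _
  have hsphere : sphereInt t (sphereLap (polyMap (biharmonicExt j q))) =
      -(j * (j + 2)) * sphereInt t (polyMap q) := by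
    rw [sphereInt_congr (sphereLap_biharmonicExt hq), sphereInt_const_mul]
  rw [hlap, hsphere, ballInt_zero, sphereInt_zero, sphereInt_smul,
    sphereInt_congr (polyMap_biharmonicExt_eqOn_sphere j q)] at hweak
  rw [sphereInt_zero] at hgreen
  have hprod : (j * (j + 1) * (j + 2) - Λ) * sphereInt t (polyMap q) = 0 := by
    linear_combination hweak - (j * (j + 2) : ℝ) * hgreen
  exact (mul_eq_zero.1 hprod).resolve_left (sub_ne_zero.2 hj)

lemma strictMono_eigenvalue : StrictMono fun k : ℕ => (k * (k + 1) * (k + 2) : ℝ) :=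
  fun a b hab => by
    dsimp only
    gcongr

lemma eigenspace_eq_map (k : ℕ) : eigenspace (k * (k + 1) * (k + 2)) =
    (harmonicSubmodule (Fin 4) ℝ k).map (polyBall ∘ₗ biharmonicExt k) := by
  refine le_antisymm (fun φ hφ => ?_) ?_
  · obtain ⟨-, hbi, ⟨t, ht, -⟩, hn⟩ := id hφ
    obtain ⟨p, hp, rfl⟩ := mem_map_polySphere_of_orthogonal (k := k) (t := t) fun j hj q hq =>
      IsSolution.sphereInt_eq_zero hφ ht (strictMono_eigenvalue.injective.ne hj) hq
    exact ⟨p, hp, (isSolution_biharmonicExt hp).2.1.eq_of_cauchyData hbi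
      (hasTrace_biharmonicExt k p) ht (isSolution_biharmonicExt hp).2.2.2 hn⟩
  · rintro _ ⟨p, hp, rfl⟩
    exact isSolution_biharmonicExt hp

lemma eigenspace_eq_bot (h : ∀ k : ℕ, Λ ≠ k * (k + 1) * (k + 2)) : eigenspace Λ = ⊥ := by
  refine (Submodule.eq_bot_iff _).2 fun φ hφ => ?_
  obtain ⟨-, hbi, ⟨t, ht, -⟩, hn⟩ := id hφ
  obtain rfl : t = 0 := eq_zero_of_sphereInt_harmonic fun j q hq =>
    IsSolution.sphereInt_eq_zero hφ ht (h j).symm hq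
  exact hbi.eq_zero ht hn

lemma finrank_eigenspace (k : ℕ) :
    Module.finrank ℝ (eigenspace (k * (k + 1) * (k + 2))) = (k + 1) ^ 2 := by
  rw [eigenspace_eq_map, ← finrank_harmonicSubmodule_four]
  exact (Submodule.equivMapOfInjective (polyBall ∘ₗ biharmonicExt k)
    (polyBall_injective.comp (biharmonicExt_injective k)) _).finrank_eq.symm

lemma isEigenvalue_iff : IsEigenvalue Λ ↔ ∃ k : ℕ, Λ = k * (k + 1) * (k + 2) := by
  have hbot : IsEigenvalue Λ ↔ eigenspace Λ ≠ ⊥ := by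
    rw [Submodule.ne_bot_iff]
    exact exists_congr fun φ => and_comm
  rw [hbot]
  refine ⟨fun h => ?_, ?_⟩
  · by_contra! hk
    exact h (eigenspace_eq_bot hk)
  · rintro ⟨k, rfl⟩ h
    have hdim := finrank_eigenspace k
    rw [h, finrank_bot] at hdim
    exact absurd hdim.symm (by positivity)

lemma existsUnique_isNeumannBiharmonicExtension (hψ : IsSteklovSolution k ψ) :
    ∃! φ, IsNeumannBiharmonicExtension φ ψ := by
  obtain ⟨p, hp, rfl⟩ := isSteklovSolution_iff_mem_map.1 hψ
  simp only [isNeumannBiharmonicExtension_polyBall_iff hp, existsUnique_eq]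

lemma coe_eigenspace_eq_neumannBiharmonicExtensions (k : ℕ) :
    (eigenspace (k * (k + 1) * (k + 2)) : Set L2Ball) =
      {φ | ∃ ψ, IsSteklovSolution k ψ ∧ IsNeumannBiharmonicExtension φ ψ} := by
  ext φ
  rw [eigenspace_eq_map]
  constructor
  · rintro ⟨p, hp, rfl⟩
    exact ⟨_, isSteklovSolution_polyBall hp, (isNeumannBiharmonicExtension_polyBall_iff hp).2 rfl⟩
  · rintro ⟨ψ, hψ, hφ⟩
    obtain ⟨p, hp, rfl⟩ := isSteklovSolution_iff_mem_map.1 hψ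
    exact ⟨p, hp, ((isNeumannBiharmonicExtension_polyBall_iff hp).1 hφ).symm⟩

lemma isSteklovSolution_iff : IsSteklovSolution k ψ ↔ ∃ p ∈ harmonicPolynomials k,
    ψ =ᵐ[ballMeasure] fun x => MvPolynomial.eval (fun i => x i) p := by
  rw [isSteklovSolution_iff_mem_map, ← coe_harmonicSubmodule]
  refine exists_congr fun p => and_congr_right fun _ => ?_
  rw [← funext (polyMap_apply p), ← eq_toL2Ball_iff]
  exact eq_comm

lemma mem_eigenspace_iff : φ ∈ eigenspace (k * (k + 1) * (k + 2)) ↔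
    ∃ p ∈ harmonicPolynomials k, φ =ᵐ[ballMeasure] fun x =>
      ((k + 2 - k * ‖x‖ ^ 2) / 2) * MvPolynomial.eval (fun i => x i) p := by
  rw [eigenspace_eq_map, ← coe_harmonicSubmodule]
  refine exists_congr fun p => and_congr_right fun _ => ?_
  have hext : (fun x : E4 => ((k + 2 - k * ‖x‖ ^ 2) / 2) * MvPolynomial.eval (fun i => x i) p) =
      polyMap (biharmonicExt k p) := by
    funext x
    rw [polyMap_biharmonicExt_apply, polyMap_apply]
    ring
  rw [hext, ← eq_toL2Ball_iff]
  exact eq_comm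

lemma isClassicalSolution_zero (Λ : ℝ) : IsClassicalSolution Λ 0 := by
  obtain ⟨hsmooth, hbi, hP, hn⟩ :=
    isClassicalSolution_biharmonicExt (zero_mem (harmonicSubmodule (Fin 4) ℝ 0))
  rw [map_zero, map_zero, ContinuousMap.coe_zero] at hsmooth hbi hP hn
  exact ⟨hsmooth, hbi, fun x hx => by simpa only [Pi.zero_apply, mul_zero] using hP x hx, hn⟩

lemma mem_eigenspace_iff_classical :
    φ ∈ eigenspace Λ ↔ ∃ f : E4 → ℝ, IsClassicalSolution Λ f ∧ φ =ᵐ[ballMeasure] f := by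
  constructor
  · intro hφ
    by_cases hΛ : ∃ k : ℕ, Λ = k * (k + 1) * (k + 2)
    · obtain ⟨k, rfl⟩ := hΛ
      rw [eigenspace_eq_map] at hφ
      obtain ⟨p, hp, rfl⟩ := hφ
      exact ⟨_, isClassicalSolution_biharmonicExt hp, coeFn_toL2Ball _⟩
    · rw [eigenspace_eq_bot (not_exists.1 hΛ), Submodule.mem_bot] at hφ
      exact ⟨0, isClassicalSolution_zero Λ, hφ ▸ Lp.coeFn_zero _ _ _⟩
  · rintro ⟨f, hf, hφ⟩
    rw [eq_toL2Ball_iff (f := ⟨f, hf.1.continuous⟩) |>.2 hφ]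
    exact hf.isSolution

end Eigenspaces

lemma exists_monotone_index {S : ℕ → ℕ} (hS : StrictMono S) (h0 : S 0 = 0) :
    ∃ index : ℕ → ℕ, Monotone index ∧ ∀ i k, index i = k ↔ i ∈ Ico (S k) (S (k + 1)) := by
  have hex (i : ℕ) : ∃ k, i < S (k + 1) := ⟨i, hS.le_apply⟩
  have hle (i k : ℕ) : Nat.find (hex i) ≤ k ↔ i < S (k + 1) := by
    rw [Nat.find_le_iff]
    exact ⟨fun ⟨m, hm, hi⟩ => hi.trans_le (hS.monotone (by omega)), fun hi => ⟨k, le_rfl, hi⟩⟩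
  refine ⟨fun i => Nat.find (hex i), fun i j hij => (hle i _).2 (hij.trans_lt ((hle j _).1 le_rfl)),
    fun i k => ?_⟩
  rw [mem_Ico, ← hle, ← not_lt, and_comm, eq_iff_le_not_lt]
  refine and_congr_right fun _ => not_congr ?_
  cases k with
  | zero => simp [h0]
  | succ k => rw [Nat.lt_succ_iff, hle]

lemma exists_spectrum_listing :
    ∃ Λ : ℕ → ℝ, Monotone Λ ∧
      (∀ μ : ℝ, {i | Λ i = μ}.encard = (Module.finrank ℝ (eigenspace μ) : ℕ∞)) ∧
      Λ 0 = 0 ∧ Λ 1 = 6 ∧ Λ 2 = 6 ∧ Λ 3 = 6 ∧ Λ 4 = 6 ∧ Λ 5 = 24 := by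
  have hmult : StrictMono fun k => ∑ j ∈ Finset.range k, (j + 1) ^ 2 :=
    strictMono_nat_of_lt_succ fun k => by
      rw [Finset.sum_range_succ]
      exact Nat.lt_add_of_pos_right (by positivity)
  obtain ⟨index, hmono, hindex⟩ := exists_monotone_index hmult rfl
  set ev : ℕ → ℝ := fun k => k * (k + 1) * (k + 2)
  refine ⟨ev ∘ index, strictMono_eigenvalue.monotone.comp hmono, fun μ => ?_, ?_⟩
  · by_cases hμ : ∃ k, μ = ev k
    · obtain ⟨k, rfl⟩ := hμ
      have hfiber : {i | (ev ∘ index) i = ev k} =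
          Finset.Ico (∑ j ∈ Finset.range k, (j + 1) ^ 2)
            (∑ j ∈ Finset.range (k + 1), (j + 1) ^ 2) := by
        ext i
        rw [Finset.coe_Ico, ← hindex]
        exact strictMono_eigenvalue.injective.eq_iff
      rw [hfiber, finrank_eigenspace, Set.encard_coe_eq_coe_finsetCard, Nat.card_Ico,
        Finset.sum_range_succ, Nat.add_sub_cancel_left]
    · rw [eigenspace_eq_bot (not_exists.1 hμ), finrank_bot, Nat.cast_zero, encard_eq_zero]
      exact eq_empty_of_forall_notMem fun i hi => hμ ⟨index i, hi.symm⟩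
  · have hlow : index 0 = 0 ∧ index 1 = 1 ∧ index 2 = 1 ∧ index 3 = 1 ∧ index 4 = 1 ∧
        index 5 = 2 := by
      simp [hindex, Finset.sum_range_succ]
    obtain ⟨h0, h1, h2, h3, h4, h5⟩ := hlow
    norm_num [ev, h0, h1, h2, h3, h4, h5]

end FlatBall

theorem proposition4p1 :
    -- the eigenvalues are exactly the numbers `k (k + 1) (k + 2)`
    (∀ Λ : ℝ, FlatBall.IsEigenvalue Λ ↔ ∃ k : ℕ, Λ = k * (k + 1) * (k + 2)) ∧
    -- multiplicities
    (∀ k : ℕ, Module.finrank ℝ (FlatBall.eigenspace (k * (k + 1) * (k + 2))) = (k + 1) ^ 2) ∧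
    -- the eigenspaces in terms of the Steklov eigenfunctions with Steklov eigenvalue `k`
    (∀ k : ℕ,
      (∀ ψ : FlatBall.L2Ball, FlatBall.IsSteklovSolution k ψ →
        ∃! φ : FlatBall.L2Ball, FlatBall.IsNeumannBiharmonicExtension φ ψ) ∧
      (FlatBall.eigenspace (k * (k + 1) * (k + 2)) : Set FlatBall.L2Ball) =
        {φ | ∃ ψ : FlatBall.L2Ball, FlatBall.IsSteklovSolution k ψ ∧
          FlatBall.IsNeumannBiharmonicExtension φ ψ}) ∧
    -- both families in terms of homogeneous harmonic polynomials of degree `k`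
    (∀ k : ℕ,
      (∀ ψ : FlatBall.L2Ball, FlatBall.IsSteklovSolution k ψ ↔
        ∃ p ∈ FlatBall.harmonicPolynomials k,
          ψ =ᵐ[FlatBall.ballMeasure] fun x => MvPolynomial.eval (fun i => x i) p) ∧
      (∀ φ : FlatBall.L2Ball, φ ∈ FlatBall.eigenspace (k * (k + 1) * (k + 2)) ↔
        ∃ p ∈ FlatBall.harmonicPolynomials k,
          φ =ᵐ[FlatBall.ballMeasure] fun x =>
            ((k + 2 - k * ‖x‖ ^ 2) / 2) * MvPolynomial.eval (fun i => x i) p)) ∧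
    -- the solutions in `H²` are the classical solutions
    (∀ (Λ : ℝ) (φ : FlatBall.L2Ball), φ ∈ FlatBall.eigenspace Λ ↔
      ∃ f : FlatBall.E4 → ℝ, FlatBall.IsClassicalSolution Λ f ∧
        φ =ᵐ[FlatBall.ballMeasure] f) ∧
    -- the beginning of the spectrum, listed in nondecreasing order with multiplicity
    (∃ Λ : ℕ → ℝ, Monotone Λ ∧
      (∀ μ : ℝ, {i | Λ i = μ}.encard = (Module.finrank ℝ (FlatBall.eigenspace μ) : ℕ∞)) ∧
      Λ 0 = 0 ∧ Λ 1 = 6 ∧ Λ 2 = 6 ∧ Λ 3 = 6 ∧ Λ 4 = 6 ∧ Λ 5 = 24) := by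
  open FlatBall in
  exact ⟨fun _ => isEigenvalue_iff, finrank_eigenspace,
    fun k => ⟨fun _ => existsUnique_isNeumannBiharmonicExtension,
      coe_eigenspace_eq_neumannBiharmonicExtensions k⟩,
    fun _ => ⟨fun _ => isSteklovSolution_iff, fun _ => mem_eigenspace_iff⟩,
    fun _ _ => mem_eigenspace_iff_classical, exists_spectrum_listing⟩
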